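/- For a finite simple graph $G=(V,E)$ and a 2-coloring $f:V\to\{\text{red},\text{blue}\}$, let $r'_f$ and $b'_f$ be the numbers of edges both of whose end-vertices are red, respectively blue. Let $\mu_f(G)=\min\{r'_f,b'_f\}$, and let $\mu(G)$ be the maximum of $\mu_f(G)$ over all 2-colorings $f$ of $V$. The problem $k$-LCP asks, given a graph $G$ and an integer $k\ge 0$ (the parameter), whether $\mu(G)\ge k$. Theorem. There is an algorithm that solves $k$-LCP in time $O^*(4^k)$. That is, there are a single random access machine program (with addition, truncated subtraction, comparison and indirect addressing, under the logarithmic cost criterion) and constants $C,c$ such that, for every $n\ge 0$, every graph $G$ with vertex set $\{0,\dots,n-1\}$, given by its adjacency matrix, and every integer $k\ge 0$, the program halts after time at most $C\cdot 4^k\cdot\bigl((k+1)(n+1)\bigr)^{c}$ and outputs $1$ if $\mu(G)\ge k$ and $0$ otherwise. -/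

import Mathlib

/-! ## Load coloring -/

namespace LoadColoring

/-- A 2-coloring of the vertex set; `true` is read as red and `false` as blue. -/
abbrev Coloring (V : Type) : Type := V → Bool

/-- The number of edges of `G` both of whose end-vertices have color `c` under `f`. -/
noncomputable def monoEdges {V : Type} (G : SimpleGraph V) (f : Coloring V) (c : Bool) : ℕ :=
  {e | e ∈ G.edgeSet ∧ ∀ v ∈ e, f v = c}.ncard

/-- The smaller of the number of red edges and the number of blue edges. -/
noncomputable def muOf {V : Type} (G : SimpleGraph V) (f : Coloring V) : ℕ :=
  min (monoEdges G f true) (monoEdges G f false)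

/-- The maximum of `muOf G f` over all 2-colorings `f`
(a supremum over a finite non-empty set, as `V` is finite). -/
noncomputable def mu {V : Type} [Finite V] (G : SimpleGraph V) : ℕ :=
  ⨆ f : Coloring V, muOf G f

end LoadColoring

/-! ## Random access machines with logarithmic cost

A machine has registers, which a program names by fixed indices, and a memory, which a program
accesses through addresses held in registers. All cells hold natural numbers of arbitrary size.
Every elementary operation and every test costs one plus the total bit length of the numbers (data
and addresses) it handles, so a large number is never handled at unit cost. -/

namespace RAM

/-- The contents of the registers and of the memory cells. -/
@[ext]
structure State where
  reg : ℕ → ℕ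
  mem : ℕ → ℕ

/-- Programs, in structured form. Write `Rᵢ` for register `i` and `M[a]` for memory cell `a`. -/
inductive Prog : Type where
  /-- Do nothing. -/
  | skip : Prog
  /-- `Rᵢ := c` -/
  | const (i c : ℕ) : Prog
  /-- `Rᵢ := Rⱼ` -/
  | copy (i j : ℕ) : Prog
  /-- `Rᵢ := Rⱼ + Rₗ` -/
  | add (i j l : ℕ) : Prog
  /-- `Rᵢ := max (Rⱼ - Rₗ, 0)` -/
  | sub (i j l : ℕ) : Prog
  /-- `Rᵢ := M[Rⱼ]` -/
  | load (i j : ℕ) : Prog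
  /-- `M[Rᵢ] := Rⱼ` -/
  | store (i j : ℕ) : Prog
  /-- First `p`, then `q`. -/
  | seq (p q : Prog) : Prog
  /-- If `Rᵢ < Rⱼ` then `p`, else `q`. -/
  | ifLt (i j : ℕ) (p q : Prog) : Prog
  /-- While `Rᵢ < Rⱼ`, do `p`. -/
  | whileLt (i j : ℕ) (p : Prog) : Prog

/-- Assign a value to a register. -/
def State.setReg (s : State) (i v : ℕ) : State :=
  { s with reg := Function.update s.reg i v }

/-- Assign a value to a memory cell. -/
def State.setMem (s : State) (a v : ℕ) : State :=
  { s with mem := Function.update s.mem a v }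

/-- The cost of an elementary operation that handles the numbers `a` and `b`;
`Nat.size` is the length of the binary expansion. -/
def opCost (a b : ℕ) : ℕ := 1 + a.size + b.size

/-- `Exec p s t s'`: started in state `s`, the program `p` halts, after time `t`, in state `s'`. -/
inductive Exec : Prog → State → ℕ → State → Prop where
  | skip (s : State) : Exec .skip s 1 s
  | const (i c : ℕ) (s : State) : Exec (.const i c) s (opCost c 0) (s.setReg i c)
  | copy (i j : ℕ) (s : State) :
      Exec (.copy i j) s (opCost (s.reg j) 0) (s.setReg i (s.reg j))
  | add (i j l : ℕ) (s : State) :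
      Exec (.add i j l) s (opCost (s.reg j) (s.reg l)) (s.setReg i (s.reg j + s.reg l))
  | sub (i j l : ℕ) (s : State) :
      Exec (.sub i j l) s (opCost (s.reg j) (s.reg l)) (s.setReg i (s.reg j - s.reg l))
  | load (i j : ℕ) (s : State) :
      Exec (.load i j) s (opCost (s.reg j) (s.mem (s.reg j))) (s.setReg i (s.mem (s.reg j)))
  | store (i j : ℕ) (s : State) :
      Exec (.store i j) s (opCost (s.reg i) (s.reg j)) (s.setMem (s.reg i) (s.reg j))
  | seq {p q : Prog} {s s' s'' : State} {t t' : ℕ} :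
      Exec p s t s' → Exec q s' t' s'' → Exec (.seq p q) s (t + t') s''
  | ifLt_true {i j : ℕ} {p q : Prog} {s s' : State} {t : ℕ} :
      s.reg i < s.reg j → Exec p s t s' →
      Exec (.ifLt i j p q) s (opCost (s.reg i) (s.reg j) + t) s'
  | ifLt_false {i j : ℕ} {p q : Prog} {s s' : State} {t : ℕ} :
      ¬ s.reg i < s.reg j → Exec q s t s' →
      Exec (.ifLt i j p q) s (opCost (s.reg i) (s.reg j) + t) s'
  | whileLt_true {i j : ℕ} {p : Prog} {s s' s'' : State} {t t' : ℕ} :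
      s.reg i < s.reg j → Exec p s t s' → Exec (.whileLt i j p) s' t' s'' →
      Exec (.whileLt i j p) s (opCost (s.reg i) (s.reg j) + t + t') s''
  | whileLt_false {i j : ℕ} {p : Prog} {s : State} :
      ¬ s.reg i < s.reg j → Exec (.whileLt i j p) s (opCost (s.reg i) (s.reg j)) s

end RAM

namespace LoadColoring

open Classical in
/-- The initial state on the instance `(G, k)`, where `G` has the vertices `0, …, n - 1`:
register `0` holds `n`, register `1` holds `k`, all other registers hold `0`, and the memory holds
the adjacency matrix of `G` row by row (the entry of `(u, v)` at address `u * n + v`), followed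
by zeros. -/
noncomputable def input {n : ℕ} (G : SimpleGraph (Fin n)) (k : ℕ) : RAM.State where
  reg i := if i = 0 then n else if i = 1 then k else 0
  mem a := if ∃ u v : Fin n, G.Adj u v ∧ a = (u : ℕ) * n + (v : ℕ) then 1 else 0

end LoadColoring

/-!
A depth-first search of `G` maintains a search path whose consecutive vertices are adjacent. If the
path ever has `2 * k + 2` vertices, cutting it in the middle into a red and a blue half shows that
`k ≤ μ(G)` (`le_mu_of_path`). Otherwise the path always has at most `2 * k + 1` vertices, hence at
most `2 * 4 ^ k` colorings, and dynamic programming over the search is fast enough.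

The table has a row for each coloring `χ` of the search path. With `S` the set of discovered
vertices, its entry `r ≤ k` is one more than the largest `b` such that `χ` extends to a coloring
with at least `r` red and at least `b` blue edges inside `S` (`Feasible`), or `0` if no extension
has `r` red edges. A discovered vertex outside the search path has only discovered neighbors, so a
new vertex `w` is joined to `S` only through the search path, and `χ` together with the color of
`w` determines the number of new red or blue edges: each new row is a shifted copy of an old one
(`SearchState.feasible_red`, `SearchState.feasible_blue`). Leaving a vertex amounts to taking the
maximum over its two colors (`feasible_pop`). When all vertices have been left, the entry `k` of the
only row decides the question. The search takes at most `2 * n` steps (`runs_stepProg`).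

The tables for search paths of different lengths `d` lie at the distinct offsets
`2 ^ d * (k + 1)`, and the color of the current vertex is the most significant digit of `χ`, so that
entering and leaving a vertex copies contiguous blocks of memory.

For the machine, `Runs` bounds the number of elementary operations and keeps all numbers below
`2 ^ L`; with `L` linear in `n` and `k` the logarithmic cost exceeds the number of operations by a
linear factor only. Programs use registers with larger indices for more deeply nested loops, so that
`Frame` expresses what a subprogram leaves unchanged.
-/

/-! ### Monochromatic edges inside a set of vertices -/

namespace LoadColoring

section Combinatorics

variable {V : Type} (G : SimpleGraph V)

/-- The number of edges of `G` inside `S` both of whose end-vertices have color `c`. -/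
noncomputable def edgesIn (f : Coloring V) (S : Finset V) (c : Bool) : ℕ :=
  {e | e ∈ G.edgeSet ∧ ∀ v ∈ e, v ∈ S ∧ f v = c}.ncard

lemma edgesIn_univ [Fintype V] (f : Coloring V) (c : Bool) :
    edgesIn G f Finset.univ c = monoEdges G f c := by
  simp [edgesIn, monoEdges]

lemma edgesIn_empty (f : Coloring V) (c : Bool) : edgesIn G f ∅ c = 0 := by
  have : {e | e ∈ G.edgeSet ∧ ∀ v ∈ e, v ∈ (∅ : Finset V) ∧ f v = c} = ∅ := by
    refine Set.eq_empty_of_forall_notMem fun e he => ?_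
    induction e with
    | _ x y => exact absurd (he.2 x (Sym2.mem_mk_left x y)).1 (by simp)
  rw [edgesIn, this, Set.ncard_empty]

lemma edgesIn_congr {f g : Coloring V} {S : Finset V} (h : ∀ v ∈ S, f v = g v) (c : Bool) :
    edgesIn G f S c = edgesIn G g S c := by
  have : ∀ v, (v ∈ S ∧ f v = c) ↔ (v ∈ S ∧ g v = c) := fun v =>
    and_congr_right fun hv => by rw [h v hv]
  simp only [edgesIn, this]

lemma edgesIn_mono [Fintype V] (f : Coloring V) {S T : Finset V} (h : S ⊆ T) (c : Bool) :
    edgesIn G f S c ≤ edgesIn G f T c :=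
  Set.ncard_le_ncard (fun _ he => ⟨he.1, fun v hv => ⟨h (he.2 v hv).1, (he.2 v hv).2⟩⟩)
    (Set.toFinite _)

lemma edgesIn_insert_of_ne [DecidableEq V] {f : Coloring V} {S : Finset V} {c : Bool} {w : V}
    (hf : f w ≠ c) :
    edgesIn G f (insert w S) c = edgesIn G f S c := by
  have : ∀ v, (v ∈ insert w S ∧ f v = c) ↔ (v ∈ S ∧ f v = c) := by
    intro v
    rw [Finset.mem_insert]
    constructor
    · rintro ⟨rfl | h, h'⟩
      · exact absurd h' hf
      · exact ⟨h, h'⟩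
    · exact fun h => ⟨Or.inr h.1, h.2⟩
  simp only [edgesIn, this]

lemma edgesIn_insert [Fintype V] [DecidableEq V] {f : Coloring V} {S : Finset V} {c : Bool}
    {w : V} (hw : w ∉ S)
    (hf : f w = c) :
    edgesIn G f (insert w S) c =
      edgesIn G f S c + {u | u ∈ S ∧ G.Adj w u ∧ f u = c}.ncard := by
  have hset : {e | e ∈ G.edgeSet ∧ ∀ v ∈ e, v ∈ insert w S ∧ f v = c} =
      {e | e ∈ G.edgeSet ∧ ∀ v ∈ e, v ∈ S ∧ f v = c} ∪
        (fun u => s(w, u)) '' {u | u ∈ S ∧ G.Adj w u ∧ f u = c} := by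
    ext e
    induction e with
    | _ x y =>
      simp only [Set.mem_ofPred_eq, SimpleGraph.mem_edgeSet, Sym2.mem_iff, forall_eq_or_imp,
        forall_eq, Finset.mem_insert, Set.mem_union, Set.mem_image, Sym2.eq_iff]
      constructor
      · rintro ⟨ha, ⟨hx | hx, hfx⟩, hy | hy, hfy⟩
        · subst hx; subst hy; exact absurd ha (G.loopless.irrefl _)
        · subst hx; exact Or.inr ⟨y, ⟨hy, ha, hfy⟩, Or.inl ⟨rfl, rfl⟩⟩
        · subst hy; exact Or.inr ⟨x, ⟨hx, ha.symm, hfx⟩, Or.inr ⟨rfl, rfl⟩⟩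
        · exact Or.inl ⟨ha, ⟨hx, hfx⟩, hy, hfy⟩
      · rintro (⟨ha, ⟨hx, hfx⟩, hy, hfy⟩ | ⟨u, ⟨hu, ha, hfu⟩, ⟨rfl, rfl⟩ | ⟨rfl, rfl⟩⟩)
        · exact ⟨ha, ⟨Or.inr hx, hfx⟩, Or.inr hy, hfy⟩
        · exact ⟨ha, ⟨Or.inl rfl, hf⟩, Or.inr hu, hfu⟩
        · exact ⟨ha.symm, ⟨Or.inr hu, hfu⟩, Or.inl rfl, hf⟩
  have hdisj : Disjoint {e | e ∈ G.edgeSet ∧ ∀ v ∈ e, v ∈ S ∧ f v = c}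
      ((fun u => s(w, u)) '' {u | u ∈ S ∧ G.Adj w u ∧ f u = c}) := by
    rw [Set.disjoint_right]
    rintro _ ⟨u, -, rfl⟩ h
    exact hw (h.2 w (Sym2.mem_mk_left w u)).1
  rw [edgesIn, hset, Set.ncard_union_eq hdisj (Set.toFinite _) (Set.toFinite _),
    Set.ncard_image_of_injective _ fun a b h => Sym2.congr_right.1 h]
  rfl

/-- A crude bound: there are at most `|V|²` edges. -/
lemma edgesIn_le [Fintype V] (f : Coloring V) (S : Finset V) (c : Bool) :
    edgesIn G f S c ≤ Fintype.card V * Fintype.card V := by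
  have h1 : edgesIn G f S c ≤ (Set.univ : Set (Sym2 V)).ncard :=
    Set.ncard_le_ncard (Set.subset_univ _) (Set.toFinite _)
  have h2 : Nat.card (Sym2 V) ≤ Nat.card (V × V) :=
    Nat.card_le_card_of_surjective (fun p : V × V => s(p.1, p.2)) fun e => by
      induction e with
      | _ x y => exact ⟨(x, y), rfl⟩
  rw [Set.ncard_univ] at h1
  rw [Nat.card_prod, Nat.card_eq_fintype_card (α := V)] at h2
  exact h1.trans h2

/-! ### Long paths give balanced colorings -/

/-- A path all of whose vertices have color `c` has all of its edges in color `c`. -/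
lemma length_le_edgesIn [Fintype V] [DecidableEq V] (f : Coloring V) (c : Bool) (l : List V)
    (hn : l.Nodup)
    (hc : l.IsChain G.Adj) (hf : ∀ v ∈ l, f v = c) : l.length ≤ edgesIn G f l.toFinset c + 1 := by
  induction l with
  | nil => simp
  | cons v l ih =>
    have ih := ih hn.of_cons hc.tail fun u hu => hf u (List.mem_cons_of_mem _ hu)
    cases l with
    | nil => simp
    | cons u l =>
      have hv : v ∉ (u :: l).toFinset := by
        rw [List.mem_toFinset]; exact (List.nodup_cons.1 hn).1
      rw [List.toFinset_cons, edgesIn_insert G hv (hf v (by simp))]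
      have hpos : 0 < {x | x ∈ (u :: l).toFinset ∧ G.Adj v x ∧ f x = c}.ncard := by
        rw [Set.ncard_pos (Set.toFinite _)]
        exact ⟨u, by simp, (List.isChain_cons_cons.1 hc).1, hf u (by simp)⟩
      rw [List.length_cons]
      omega

lemma le_mu_iff [Fintype V] (k : ℕ) :
    k ≤ mu G ↔ ∃ f, k ≤ edgesIn G f Finset.univ true ∧ k ≤ edgesIn G f Finset.univ false := by
  have hb : BddAbove (Set.range fun f : Coloring V => muOf G f) := Set.toFinite _ |>.bddAbove
  simp only [edgesIn_univ, ← le_min_iff]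
  constructor
  · intro h
    obtain ⟨f, hf⟩ := Nat.sSup_mem (Set.range_nonempty fun f : Coloring V => muOf G f) hb
    refine ⟨f, h.trans ?_⟩
    exact hf.ge
  · rintro ⟨f, hf⟩
    exact hf.trans (le_ciSup hb f)

/-- Cut a path on `2k + 2` vertices in the middle and color one half red, the other half blue. -/
lemma le_mu_of_path [Fintype V] {k : ℕ} {l : List V} (hn : l.Nodup) (hc : l.IsChain G.Adj)
    (hl : 2 * k + 2 ≤ l.length) : k ≤ mu G := by
  classical
  rw [le_mu_iff]
  have hn' := hn
  have hc' := hc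
  rw [← List.take_append_drop (k + 1) l] at hn' hc'
  obtain ⟨hn1, hn2, hd⟩ := List.nodup_append'.1 hn'
  obtain ⟨hc1, hc2, -⟩ := List.isChain_append.1 hc'
  refine ⟨fun v => decide (v ∈ l.take (k + 1)), ?_, ?_⟩
  · have := length_le_edgesIn G (fun v => decide (v ∈ l.take (k + 1))) true _ hn1 hc1
      fun v hv => by simpa using hv
    have h2 := edgesIn_mono G (fun v => decide (v ∈ l.take (k + 1)))
      (Finset.subset_univ (l.take (k + 1)).toFinset) true
    rw [List.length_take] at this
    omega
  · have := length_le_edgesIn G (fun v => decide (v ∈ l.take (k + 1))) false _ hn2 hc2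
      fun v hv => by simpa using fun h => hd h hv
    have h2 := edgesIn_mono G (fun v => decide (v ∈ l.take (k + 1)))
      (Finset.subset_univ (l.drop (k + 1)).toFinset) false
    rw [List.length_drop] at this
    omega

/-! ### Colorings of the search path and feasible pairs -/

/-- The coloring `f` restricted to the list `l` is encoded by the binary digits of `χ`: the last
entry of `l` has the color given by digit `0`, the head of `l` the color given by digit
`l.length - 1`. -/
def Agree (f : Coloring V) (χ : ℕ) : List V → Prop
  | [] => True
  | v :: l => f v = χ.testBit l.length ∧ Agree f χ l

open Classical in
/-- The number of neighbors of `w` on the list `l` that have color `c` in the coloring of `l`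
encoded by `χ`. -/
noncomputable def nbrCount (w : V) (χ : ℕ) (c : Bool) : List V → ℕ
  | [] => 0
  | v :: l => (if G.Adj w v ∧ χ.testBit l.length = c then 1 else 0) + nbrCount w χ c l

lemma nbrCount_le_length (w : V) (χ : ℕ) (c : Bool) (l : List V) :
    nbrCount G w χ c l ≤ l.length := by
  induction l with
  | nil => simp [nbrCount]
  | cons v l ih =>
    rw [nbrCount, List.length_cons]
    split_ifs <;> omega

lemma agree_congr {f : Coloring V} {χ χ' : ℕ} {l : List V}
    (h : ∀ i < l.length, χ.testBit i = χ'.testBit i) : Agree f χ l ↔ Agree f χ' l := by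
  induction l with
  | nil => simp [Agree]
  | cons v l ih =>
    rw [Agree, Agree, h l.length (by simp), ih fun i hi => h i (by simp; omega)]

lemma agree_congr_left {f g : Coloring V} {χ : ℕ} {l : List V} (h : ∀ v ∈ l, f v = g v) :
    Agree f χ l ↔ Agree g χ l := by
  induction l with
  | nil => simp [Agree]
  | cons v l ih =>
    rw [Agree, Agree, h v (by simp), ih fun u hu => h u (List.mem_cons_of_mem _ hu)]

lemma ncard_nbr_eq_nbrCount [Fintype V] {f : Coloring V} {χ : ℕ} {l : List V} (hn : l.Nodup)
    (hf : Agree f χ l) (w : V) (c : Bool) :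
    {u | u ∈ l ∧ G.Adj w u ∧ f u = c}.ncard = nbrCount G w χ c l := by
  classical
  induction l with
  | nil => simp [nbrCount]
  | cons v l ih =>
    rw [nbrCount, ← ih hn.of_cons hf.2, ← hf.1]
    by_cases h : G.Adj w v ∧ f v = c
    · rw [if_pos h, add_comm, ← Set.ncard_insert_of_notMem
        (a := v) (fun hv => (List.nodup_cons.1 hn).1 hv.1) (Set.toFinite _)]
      congr 1
      ext u
      simp only [List.mem_cons, Set.mem_ofPred_eq, Set.mem_insert_iff]
      constructor
      · rintro ⟨rfl | hu, h'⟩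
        · exact Or.inl rfl
        · exact Or.inr ⟨hu, h'⟩
      · rintro (rfl | ⟨hu, h'⟩)
        · exact ⟨Or.inl rfl, h⟩
        · exact ⟨Or.inr hu, h'⟩
    · rw [if_neg h, zero_add]
      congr 1
      ext u
      simp only [List.mem_cons, Set.mem_ofPred_eq]
      constructor
      · rintro ⟨rfl | hu, h'⟩
        · exact absurd h' h
        · exact ⟨hu, h'⟩
      · rintro ⟨hu, h'⟩
        exact ⟨Or.inr hu, h'⟩

/-- The coloring of `l` encoded by `χ` extends to one with at least `r` red and at least `b` blue
edges inside `S`. -/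
def Feasible (l : List V) (S : Finset V) (χ r b : ℕ) : Prop :=
  ∃ f : Coloring V, Agree f χ l ∧ r ≤ edgesIn G f S true ∧ b ≤ edgesIn G f S false

/-- The state of a depth-first search: `S` is the set of discovered vertices, and `l` is the path
from the root of the current search tree to the current vertex, which is the head of `l`. The
vertices of `S` outside `l` are finished: all their neighbors have been discovered. -/
structure SearchState (S : Finset V) (l : List V) : Prop where
  nodup : l.Nodup
  subset : ∀ v ∈ l, v ∈ S
  chain : l.IsChain G.Adj
  finished : ∀ u ∈ S, u ∉ l → ∀ v, G.Adj u v → v ∈ S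

variable {G}

lemma SearchState.empty : SearchState G ∅ [] := by
  constructor <;> simp

lemma SearchState.push [DecidableEq V] {S : Finset V} {l : List V} (h : SearchState G S l) {w : V}
    (hw : w ∉ S)
    (hl : ∀ v ∈ l.head?, G.Adj v w) : SearchState G (insert w S) (w :: l) where
  nodup := List.nodup_cons.2 ⟨fun h' => hw (h.subset w h'), h.nodup⟩
  subset v hv := by
    rcases List.mem_cons.1 hv with rfl | hv
    · exact Finset.mem_insert_self _ _
    · exact Finset.mem_insert_of_mem (h.subset v hv)
  chain := by
    cases l with
    | nil => simp
    | cons v l => exact List.isChain_cons_cons.2 ⟨(hl v (by simp)).symm, h.chain⟩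
  finished u hu hul v huv := by
    rw [List.mem_cons, not_or] at hul
    rcases Finset.mem_insert.1 hu with hu | hu
    · exact absurd hu hul.1
    · exact Finset.mem_insert_of_mem (h.finished u hu hul.2 v huv)

lemma SearchState.pop {S : Finset V} {l : List V} {v : V} (h : SearchState G S (v :: l))
    (hv : ∀ w, G.Adj v w → w ∈ S) : SearchState G S l where
  nodup := h.nodup.of_cons
  subset u hu := h.subset u (List.mem_cons_of_mem _ hu)
  chain := h.chain.tail
  finished u hu hul w huw := by
    by_cases huv : u = v
    · exact hv w (huv ▸ huw)
    · exact h.finished u hu (by simp [huv, hul]) w huw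

lemma SearchState.length_le {S : Finset V} {l : List V} (h : SearchState G S l) :
    l.length ≤ S.card := by
  classical
  rw [← List.toFinset_card_of_nodup h.nodup]
  exact Finset.card_le_card fun v hv => h.subset v (List.mem_toFinset.1 hv)

/-- All neighbors of an undiscovered vertex among the discovered ones lie on the search path. -/
lemma SearchState.ncard_nbr [Fintype V] {S : Finset V} {l : List V} (h : SearchState G S l) {w : V}
    (hw : w ∉ S) {f : Coloring V} {χ : ℕ} (hf : Agree f χ l) (c : Bool) :
    {u | u ∈ S ∧ G.Adj w u ∧ f u = c}.ncard = nbrCount G w χ c l := by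
  rw [← ncard_nbr_eq_nbrCount G h.nodup hf]
  congr 1
  ext u
  refine and_congr_left fun hu => ⟨fun hS => ?_, h.subset u⟩
  by_contra hul
  exact hw (h.finished u hS hul w hu.1.symm)

/-- The colorings that extend `χ'` on `w :: l`, compared with those that extend `χ` on `l`: the new
vertex `w` adds the edges to its neighbors of its own color on the search path. -/
lemma SearchState.exists_update [Fintype V] [DecidableEq V] {S : Finset V} {l : List V}
    (h : SearchState G S l) {w : V}
    (hw : w ∉ S) {χ χ' : ℕ} (hχ : ∀ i < l.length, χ'.testBit i = χ.testBit i)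
    (p : ℕ → ℕ → Prop) :
    (∃ f, Agree f χ' (w :: l) ∧
        p (edgesIn G f (insert w S) true) (edgesIn G f (insert w S) false)) ↔
      ∃ f, Agree f χ l ∧
        p (edgesIn G f S true + if χ'.testBit l.length then nbrCount G w χ true l else 0)
          (edgesIn G f S false + if χ'.testBit l.length then 0 else nbrCount G w χ false l) := by
  have key : ∀ f, Agree f χ' (w :: l) → ∀ c, edgesIn G f (insert w S) c = edgesIn G f S c +
      if χ'.testBit l.length = c then nbrCount G w χ c l else 0 := by
    intro f hf c
    split_ifs with hc
    · rw [edgesIn_insert G hw (hf.1.trans hc), h.ncard_nbr hw ((agree_congr hχ).1 hf.2)]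
    · rw [edgesIn_insert_of_ne G (by rwa [hf.1]), add_zero]
  constructor
  · rintro ⟨f, hf, hp⟩
    refine ⟨f, (agree_congr hχ).1 hf.2, ?_⟩
    rw [key f hf, key f hf] at hp
    cases hb : χ'.testBit l.length <;> simpa [hb] using hp
  · rintro ⟨f, hf, hp⟩
    -- recoloring `w` does not affect the edges inside `S`
    have hS : ∀ v ∈ S, Function.update f w (χ'.testBit l.length) v = f v := fun v hv =>
      Function.update_of_ne (fun h' : v = w => hw (h' ▸ hv)) _ _
    have hg : Agree (Function.update f w (χ'.testBit l.length)) χ' (w :: l) :=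
      ⟨Function.update_self _ _ _, (agree_congr hχ).2
        ((agree_congr_left fun v hv => hS v (h.subset v hv)).2 hf)⟩
    refine ⟨_, hg, ?_⟩
    rw [key _ hg, key _ hg, edgesIn_congr G hS, edgesIn_congr G hS]
    cases hb : χ'.testBit l.length <;> simpa [hb] using hp

/-- Discovering `w` and coloring it blue. -/
lemma SearchState.feasible_blue [Fintype V] [DecidableEq V] {S : Finset V} {l : List V}
    (h : SearchState G S l) {w : V}
    (hw : w ∉ S) {χ : ℕ} (hχ : χ < 2 ^ l.length) (r b : ℕ) :
    Feasible G (w :: l) (insert w S) χ r b ↔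
      Feasible G l S χ r (b - nbrCount G w χ false l) := by
  have := h.exists_update hw (χ := χ) (χ' := χ) (fun _ _ => rfl) fun x y => r ≤ x ∧ b ≤ y
  simpa [Feasible, Nat.testBit_lt_two_pow hχ, Nat.sub_le_iff_le_add] using this

/-- Discovering `w` and coloring it red. -/
lemma SearchState.feasible_red [Fintype V] [DecidableEq V] {S : Finset V} {l : List V}
    (h : SearchState G S l) {w : V}
    (hw : w ∉ S) {χ : ℕ} (hχ : χ < 2 ^ l.length) (r b : ℕ) :
    Feasible G (w :: l) (insert w S) (2 ^ l.length + χ) r b ↔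
      Feasible G l S χ (r - nbrCount G w χ true l) b := by
  have := h.exists_update hw (χ := χ) (χ' := 2 ^ l.length + χ)
    (fun i hi => Nat.testBit_two_pow_add_gt hi χ) fun x y => r ≤ x ∧ b ≤ y
  simpa [Feasible, Nat.testBit_two_pow_add_eq, Nat.testBit_lt_two_pow hχ,
    Nat.sub_le_iff_le_add] using this

lemma feasible_pop {S : Finset V} {l : List V} {v : V} {χ : ℕ} (hχ : χ < 2 ^ l.length)
    (r b : ℕ) : Feasible G l S χ r b ↔
      Feasible G (v :: l) S χ r b ∨ Feasible G (v :: l) S (2 ^ l.length + χ) r b := by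
  have h1 : ∀ f : Coloring V, Agree f (2 ^ l.length + χ) l ↔ Agree f χ l := fun f =>
    agree_congr fun i hi => Nat.testBit_two_pow_add_gt hi χ
  simp only [Feasible, Agree, Nat.testBit_two_pow_add_eq, Nat.testBit_lt_two_pow hχ, h1,
    ← exists_or]
  refine exists_congr fun f => ?_
  cases f v <;> simp

lemma feasible_init (r b : ℕ) : Feasible G [] ∅ 0 r b ↔ r = 0 ∧ b = 0 := by
  simp [Feasible, Agree, edgesIn_empty]

lemma feasible_final [Fintype V] (k : ℕ) : Feasible G [] Finset.univ 0 k k ↔ k ≤ mu G := by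
  simp [Feasible, Agree, le_mu_iff]

lemma Feasible.le_card [Fintype V] {S : Finset V} {l : List V} {χ r b : ℕ}
    (h : Feasible G l S χ r b) :
    b ≤ Fintype.card V * Fintype.card V := by
  obtain ⟨f, -, -, hb⟩ := h
  exact hb.trans (edgesIn_le G f S false)

end Combinatorics

end LoadColoring

/-! ### A program logic with time bounds -/

namespace RAM

/-- All registers and memory cells hold numbers of at most `L` binary digits. -/
def State.Bdd (L : ℕ) (s : State) : Prop :=
  (∀ i, s.reg i < 2 ^ L) ∧ ∀ a, s.mem a < 2 ^ L

/-- Started in `s`, the program `p` performs at most `T` elementary operations and tests, keeps all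
numbers below `2 ^ L` if they are so in `s`, and ends in a state satisfying `Q`. As each operation
handles two numbers, it costs at most `2 * L + 1`. -/
def Runs (L : ℕ) (p : Prog) (s : State) (T : ℕ) (Q : State → Prop) : Prop :=
  s.Bdd L → ∃ t s', Exec p s t s' ∧ t ≤ T * (2 * L + 1) ∧ s'.Bdd L ∧ Q s'

@[simp] lemma State.setReg_reg (s : State) (i v j : ℕ) :
    (s.setReg i v).reg j = if j = i then v else s.reg j := by
  simp [State.setReg, Function.update_apply]

@[simp] lemma State.setReg_mem (s : State) (i v : ℕ) : (s.setReg i v).mem = s.mem := rfl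

@[simp] lemma State.setMem_reg (s : State) (a v : ℕ) : (s.setMem a v).reg = s.reg := rfl

@[simp] lemma State.setMem_mem (s : State) (a v b : ℕ) :
    (s.setMem a v).mem b = if b = a then v else s.mem b := by
  simp [State.setMem, Function.update_apply]

lemma State.Bdd.setReg {L : ℕ} {s : State} (h : s.Bdd L) {i v : ℕ} (hv : v < 2 ^ L) :
    (s.setReg i v).Bdd L :=
  ⟨fun j => by rw [setReg_reg]; split_ifs; exacts [hv, h.1 j], h.2⟩

lemma State.Bdd.setMem {L : ℕ} {s : State} (h : s.Bdd L) {a v : ℕ} (hv : v < 2 ^ L) :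
    (s.setMem a v).Bdd L :=
  ⟨h.1, fun j => by rw [setMem_mem]; split_ifs; exacts [hv, h.2 j]⟩

lemma opCost_le {L a b : ℕ} (ha : a < 2 ^ L) (hb : b < 2 ^ L) : opCost a b ≤ 1 * (2 * L + 1) := by
  have := Nat.size_le.2 ha
  have := Nat.size_le.2 hb
  unfold opCost
  omega

variable {L : ℕ} {s : State}

lemma Runs.mono {p : Prog} {T T' : ℕ} {Q Q' : State → Prop} (h : Runs L p s T Q) (hT : T ≤ T')
    (hQ : ∀ s', Q s' → Q' s') : Runs L p s T' Q' := fun hs => by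
  obtain ⟨t, s', he, ht, hb, hq⟩ := h hs
  exact ⟨t, s', he, ht.trans (Nat.mul_le_mul_right _ hT), hb, hQ s' hq⟩

lemma Runs.seq {p q : Prog} {T T' : ℕ} {Q R : State → Prop} (h : Runs L p s T Q)
    (h' : ∀ s', Q s' → Runs L q s' T' R) : Runs L (.seq p q) s (T + T') R := fun hs => by
  obtain ⟨t, s', he, ht, hb, hq⟩ := h hs
  obtain ⟨t', s'', he', ht', hb', hr⟩ := h' s' hq hb
  exact ⟨t + t', s'', .seq he he', by rw [Nat.add_mul]; exact Nat.add_le_add ht ht', hb', hr⟩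

lemma Runs.ifLt {i j : ℕ} {p q : Prog} {T : ℕ} {Q : State → Prop}
    (h : s.reg i < s.reg j → Runs L p s T Q) (h' : ¬ s.reg i < s.reg j → Runs L q s T Q) :
    Runs L (.ifLt i j p q) s (1 + T) Q := fun hs => by
  have hc := opCost_le (hs.1 i) (hs.1 j)
  by_cases hlt : s.reg i < s.reg j
  · obtain ⟨t, s', he, ht, hb, hq⟩ := h hlt hs
    exact ⟨_, s', .ifLt_true hlt he, by rw [Nat.add_mul]; exact Nat.add_le_add hc ht, hb, hq⟩
  · obtain ⟨t, s', he, ht, hb, hq⟩ := h' hlt hs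
    exact ⟨_, s', .ifLt_false hlt he, by rw [Nat.add_mul]; exact Nat.add_le_add hc ht, hb, hq⟩

/-- The invariant `I m` says that exactly `m` more rounds of the loop are to come. -/
lemma Runs.whileLt {i j : ℕ} {p : Prog} {T : ℕ} (I : ℕ → State → Prop)
    (h0 : ∀ s, I 0 s → ¬ s.reg i < s.reg j)
    (h1 : ∀ m s, I (m + 1) s → s.reg i < s.reg j ∧ Runs L p s T (I m)) (m : ℕ) :
    ∀ s, I m s → Runs L (.whileLt i j p) s (1 + m * (1 + T)) (I 0) := by
  induction m with
  | zero =>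
    intro s hI hs
    exact ⟨_, s, .whileLt_false (h0 s hI), by simpa using opCost_le (hs.1 i) (hs.1 j), hs, hI⟩
  | succ m ih =>
    intro s hI hs
    obtain ⟨hlt, hr⟩ := h1 m s hI
    obtain ⟨t, s', he, ht, hb, hq⟩ := hr hs
    obtain ⟨t', s'', he', ht', hb', hr'⟩ := ih s' hq hb
    have hc := opCost_le (hs.1 i) (hs.1 j)
    refine ⟨_, s'', .whileLt_true hlt he he', ?_, hb', hr'⟩
    calc _ ≤ 1 * (2 * L + 1) + T * (2 * L + 1) + (1 + m * (1 + T)) * (2 * L + 1) := by omega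
      _ = _ := by ring

/-- Sequential composition of a list of programs. -/
def block : List Prog → Prog
  | [] => .skip
  | p :: l => .seq p (block l)

/-- `for i := 0, …, Rⱼ - 1 do p`; register `3` has to hold `1`. -/
def forLt (i j : ℕ) (p : Prog) : Prog :=
  .seq (.const i 0) (.whileLt i j (.seq p (.add i i 3)))

/-- The number of elementary operations and tests in the text of a program. -/
def Prog.length : Prog → ℕ
  | .seq p q => p.length + q.length
  | .ifLt _ _ p q => 1 + (p.length + q.length)
  | _ => 1

/-- The weakest precondition of a loop-free program: computing it amounts to symbolic execution. -/
def wp (L : ℕ) : Prog → (State → Prop) → State → Prop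
  | .skip, Q, s => Q s
  | .const i c, Q, s => c < 2 ^ L ∧ Q (s.setReg i c)
  | .copy i j, Q, s => Q (s.setReg i (s.reg j))
  | .add i j l, Q, s => s.reg j + s.reg l < 2 ^ L ∧ Q (s.setReg i (s.reg j + s.reg l))
  | .sub i j l, Q, s => Q (s.setReg i (s.reg j - s.reg l))
  | .load i j, Q, s => Q (s.setReg i (s.mem (s.reg j)))
  | .store i j, Q, s => Q (s.setMem (s.reg i) (s.reg j))
  | .seq p q, Q, s => wp L p (wp L q Q) s
  | .ifLt i j p q, Q, s =>
    (s.reg i < s.reg j → wp L p Q s) ∧ (s.reg j ≤ s.reg i → wp L q Q s)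
  | .whileLt _ _ _, _, _ => False

lemma Runs.of_wp {p : Prog} {Q : State → Prop} (h : wp L p Q s) : Runs L p s p.length Q := by
  induction p generalizing Q s with
  | skip => exact fun hs => ⟨_, _, .skip s, by simp [Prog.length], hs, h⟩
  | const i c =>
    exact fun hs => ⟨_, _, .const i c s, opCost_le h.1 (Nat.two_pow_pos L), hs.setReg h.1, h.2⟩
  | copy i j =>
    exact fun hs => ⟨_, _, .copy i j s, opCost_le (hs.1 j) (Nat.two_pow_pos L),
      hs.setReg (hs.1 j), h⟩
  | add i j l =>
    exact fun hs => ⟨_, _, .add i j l s, opCost_le (hs.1 j) (hs.1 l), hs.setReg h.1, h.2⟩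
  | sub i j l =>
    exact fun hs => ⟨_, _, .sub i j l s, opCost_le (hs.1 j) (hs.1 l),
      hs.setReg ((Nat.sub_le _ _).trans_lt (hs.1 j)), h⟩
  | load i j =>
    exact fun hs => ⟨_, _, .load i j s, opCost_le (hs.1 j) (hs.2 _), hs.setReg (hs.2 _), h⟩
  | store i j =>
    exact fun hs => ⟨_, _, .store i j s, opCost_le (hs.1 i) (hs.1 j), hs.setMem (hs.1 j), h⟩
  | seq p q ihp ihq => exact (ihp h).seq fun s' hs' => ihq hs'
  | ifLt i j p q ihp ihq =>
    exact Runs.ifLt (fun hlt => (ihp (h.1 hlt)).mono (by omega) fun _ => id)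
      fun hlt => (ihq (h.2 (not_lt.1 hlt))).mono (by omega) fun _ => id
  | whileLt i j p ih => exact h.elim

/-- The invariant `I m` holds after `m` rounds of the loop. -/
lemma Runs.forLt {i j : ℕ} {p : Prog} {T N : ℕ} (I : ℕ → State → Prop)
    (hj : ∀ m s, m ≤ N → I m s → s.reg j = N)
    (h0 : I 0 (s.setReg i 0))
    (h1 : ∀ m s, m < N → s.reg i = m → I m s →
      Runs L p s T fun s' => s'.reg i = m ∧ s'.reg 3 = 1 ∧ I (m + 1) (s'.setReg i (m + 1))) :
    Runs L (forLt i j p) s (2 + N * (T + 2)) (I N) := fun hs => by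
  -- `N` is the value of a register, so the counter respects the bound on the size of numbers
  have hN : N < 2 ^ L := hj 0 _ (Nat.zero_le _) h0 ▸ (hs.setReg (Nat.two_pow_pos L)).1 j
  have hw := Runs.whileLt (L := L) (i := i) (j := j) (p := .seq p (.add i i 3)) (T := T + 1)
    (fun r s => r ≤ N ∧ s.reg i = N - r ∧ I (N - r) s)
    (fun s h => by
      have h2 : I N s := h.2.2
      have := hj N s le_rfl h2
      have : s.reg i = N := h.2.1
      omega)
    (fun r s h => by
      obtain ⟨hr, hi, hI⟩ := h
      have hlt : N - (r + 1) < N := by omega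
      have hjs := hj _ s hlt.le hI
      refine ⟨by omega, ?_⟩
      refine (h1 _ s hlt hi hI).seq fun s' hs' => Runs.of_wp ?_
      obtain ⟨ha, hb, hc⟩ := hs'
      have he : N - (r + 1) + 1 = N - r := by omega
      rw [he] at hc
      simp only [wp, ha, hb, he]
      refine ⟨by omega, by omega, by simp, hc⟩) N
  have hall : Runs L (.seq (.const i 0) (.whileLt i j (.seq p (.add i i 3)))) s
      (1 + (1 + N * (1 + (T + 1)))) (I N) :=
    (Runs.of_wp (p := .const i 0) (Q := fun s' => s' = s.setReg i 0)
      ⟨Nat.two_pow_pos L, rfl⟩).seq fun s' hs' =>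
      (hw s' (by subst hs'; simpa using h0)).mono le_rfl fun s'' h => h.2.2
  exact (hall.mono (by ring_nf; rfl) fun _ => id) hs

lemma Runs.nil {Q : State → Prop} (h : Q s) : Runs L (block []) s 1 Q :=
  Runs.of_wp h

lemma Runs.cons {p : Prog} {l : List Prog} {T T' : ℕ} {Q R : State → Prop} (h : Runs L p s T Q)
    (h' : ∀ s', Q s' → Runs L (block l) s' T' R) : Runs L (block (p :: l)) s (T + T') R :=
  h.seq h'

/-- The states `s` and `s'` agree on the registers below `m`. -/
def Frame (m : ℕ) (s s' : State) : Prop :=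
  ∀ i < m, s'.reg i = s.reg i

lemma Frame.refl (m : ℕ) (s : State) : Frame m s s := fun _ _ => rfl

lemma Frame.trans {m : ℕ} {s s' s'' : State} (h : Frame m s s') (h' : Frame m s' s'') :
    Frame m s s'' := fun i hi => (h' i hi).trans (h i hi)

lemma Frame.mono {m m' : ℕ} {s s' : State} (h : Frame m s s') (hm : m' ≤ m) : Frame m' s s' :=
  fun i hi => h i (hi.trans_le hm)

lemma Frame.setReg {m : ℕ} {s s' : State} (h : Frame m s s') {i v : ℕ} (hi : m ≤ i) :
    Frame m s (s'.setReg i v) := fun j hj => by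
  rw [State.setReg_reg, if_neg (by omega), h j hj]

lemma Frame.setMem {m : ℕ} {s s' : State} (h : Frame m s s') {a v : ℕ} :
    Frame m s (s'.setMem a v) := h

end RAM

/-! ### Powers of two and neighbor counts -/

namespace LoadColoring

open RAM

/-- `R₁₄ := 2 ^ d` and `R₁₅ := 2 ^ d * (k + 1)`, where `d` is in register `10` and `k + 1` in
register `4`. -/
def powProg : Prog :=
  block [.const 14 1, .copy 15 4, forLt 16 10 (block [.add 14 14 14, .add 15 15 15])]

lemma runs_powProg {L d W : ℕ} {s : State} (h3 : s.reg 3 = 1) (h4 : s.reg 4 = W)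
    (h10 : s.reg 10 = d) (hL : 2 ^ d < 2 ^ L) (hLW : 2 ^ d * W < 2 ^ L) :
    Runs L powProg s (5 * d + 5) fun s' =>
      Frame 14 s s' ∧ s'.mem = s.mem ∧ s'.reg 14 = 2 ^ d ∧ s'.reg 15 = 2 ^ d * W := by
  have h1 := Nat.one_le_two_pow (n := d)
  refine Runs.mono (Runs.cons (Q := fun s' => s' = s.setReg 14 1) (Runs.of_wp ?_) fun s1 hs1 =>
    Runs.cons (Q := fun s' => s' = (s.setReg 14 1).setReg 15 W) (Runs.of_wp ?_) fun s2 hs2 =>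
    Runs.cons (Runs.forLt (N := d) (T := 3) (fun m s' =>
      Frame 14 s s' ∧ s'.mem = s.mem ∧ s'.reg 14 = 2 ^ m ∧ s'.reg 15 = 2 ^ m * W)
      ?_ ?_ ?_) fun s3 hs3 => Runs.nil hs3) ?_ fun s' h => h
  · simp only [wp, and_true]; omega
  · subst hs1; simp [wp, h4]
  · intro m s' _ h; rw [h.1 10 (by norm_num), h10]
  · subst hs2
    refine ⟨?_, ?_, ?_, ?_⟩
    · exact (((Frame.refl 14 s).setReg (by norm_num)).setReg (by norm_num)).setReg (by norm_num)
    all_goals simp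
  · rintro m s' hm hi ⟨hf, hmem, h14, h15⟩
    have hp : 2 ^ (m + 1) ≤ 2 ^ d := Nat.pow_le_pow_right (by norm_num) hm
    have hpW : 2 ^ (m + 1) * W ≤ 2 ^ d * W := Nat.mul_le_mul_right _ hp
    have e3 : s'.reg 3 = 1 := by rw [hf 3 (by norm_num), h3]
    rw [pow_succ] at hp hpW
    refine Runs.of_wp ?_
    simp only [block, wp, State.setReg_reg, State.setReg_mem, h14, h15]
    norm_num
    refine ⟨by omega, by linarith, hi, e3, ?_, hmem, by ring, by ring⟩
    repeat refine Frame.setReg ?_ (by norm_num)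
    exact hf
  · simp [Prog.length]; omega

/-- The search path `l` is stored from address `base` on, its last vertex first; the vertex `v` is
represented by the address `v * n` of its row of the adjacency matrix. -/
def StackAt {n : ℕ} (mem : ℕ → ℕ) (base : ℕ) : List (Fin n) → Prop
  | [] => True
  | v :: l => mem (base + l.length) = v * n ∧ StackAt mem base l

lemma StackAt.congr {n base : ℕ} {mem mem' : ℕ → ℕ} {l : List (Fin n)} (h : StackAt mem base l)
    (hm : ∀ i < l.length, mem' (base + i) = mem (base + i)) : StackAt mem' base l := by
  induction l with
  | nil => trivial
  | cons v l ih =>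
    exact ⟨(hm _ (by simp)).trans h.1, ih h.2 fun i hi => hm i (by simp; omega)⟩

open Classical in
/-- The adjacency matrix of `G` is stored row by row from address `0` on. -/
def AdjAt {n : ℕ} (G : SimpleGraph (Fin n)) (mem : ℕ → ℕ) : Prop :=
  ∀ u v : Fin n, mem (u * n + v) = if G.Adj u v then 1 else 0

lemma row_add_lt {n : ℕ} (u v : Fin n) : (u : ℕ) * n + v < n * n := by
  have := Nat.mul_le_mul_right n (Nat.succ_le_of_lt u.2)
  have hv := v.2
  rw [Nat.succ_mul] at this
  omega

/-- One doubling of the number `χ % 2 ^ (m + 1)`, shifted to `d` digits, produces the digit `m` of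
`χ` as a carry. -/
lemma double_shift {χ m d : ℕ} (hm : m + 1 ≤ d) :
    χ % 2 ^ (m + 1) * 2 ^ (d - (m + 1)) + χ % 2 ^ (m + 1) * 2 ^ (d - (m + 1)) =
      χ % 2 ^ m * 2 ^ (d - m) + if χ.testBit m then 2 ^ d else 0 := by
  obtain ⟨e, rfl⟩ := Nat.exists_eq_add_of_le hm
  have h1 : m + 1 + e - (m + 1) = e := by omega
  have h2 : m + 1 + e - m = e + 1 := by omega
  have hb : χ / 2 ^ m % 2 = (χ.testBit m).toNat := (Nat.toNat_testBit χ m).symm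
  rw [Nat.mod_pow_succ, hb, h1, h2]
  cases χ.testBit m <;> simp <;> ring

lemma mod_shift_lt {χ m d : ℕ} (hm : m ≤ d) : χ % 2 ^ m * 2 ^ (d - m) < 2 ^ d := by
  calc _ < 2 ^ m * 2 ^ (d - m) :=
        Nat.mul_lt_mul_of_pos_right (Nat.mod_lt _ (Nat.two_pow_pos m)) (Nat.two_pow_pos _)
    _ = 2 ^ d := by rw [← pow_add]; congr 1; omega

/-- `R₂₀` and `R₂₁` become the numbers of blue and red neighbors of the vertex in register `12` on
the search path, whose coloring is in register `19`. The digits of the coloring, the most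
significant first, are the carries in repeated doublings modulo `R₁₄`. -/
def countProg : Prog :=
  block [.copy 22 19, .const 20 0, .const 21 0, .add 23 6 10,
    .whileLt 6 23 (block [.sub 23 23 3, .load 24 23, .add 24 24 12, .load 24 24, .add 22 22 22,
      .ifLt 22 14 (.add 20 20 24) (block [.sub 22 22 14, .add 21 21 24])])]

lemma runs_countProg {L n χ base : ℕ} {G : SimpleGraph (Fin n)} {l : List (Fin n)} {w : Fin n}
    {s : State} (h3 : s.reg 3 = 1) (h6 : s.reg 6 = base) (h10 : s.reg 10 = l.length)
    (h12 : s.reg 12 = w) (h14 : s.reg 14 = 2 ^ l.length) (h19 : s.reg 19 = χ)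
    (hχ : χ < 2 ^ l.length) (hadj : AdjAt G s.mem) (hst : StackAt s.mem base l)
    (hbase : n * n ≤ base) (hL : base + l.length < 2 ^ L) (hL' : 2 * 2 ^ l.length < 2 ^ L) :
    Runs L countProg s (12 * l.length + 6) fun s' => Frame 20 s s' ∧ s'.mem = s.mem ∧
      s'.reg 20 = nbrCount G w χ false l ∧ s'.reg 21 = nbrCount G w χ true l := by
  have key := Runs.whileLt (L := L) (i := 6) (j := 23) (T := 11)
    (p := block [.sub 23 23 3, .load 24 23, .add 24 24 12, .load 24 24, .add 22 22 22,
      .ifLt 22 14 (.add 20 20 24) (block [.sub 22 22 14, .add 21 21 24])])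
    (fun m s' => ∃ l' : List (Fin n), l'.length = m ∧ m ≤ l.length ∧ StackAt s.mem base l' ∧
      Frame 20 s s' ∧ s'.mem = s.mem ∧ s'.reg 23 = base + m ∧
      s'.reg 22 = χ % 2 ^ m * 2 ^ (l.length - m) ∧
      s'.reg 20 + nbrCount G w χ false l' = nbrCount G w χ false l ∧
      s'.reg 21 + nbrCount G w χ true l' = nbrCount G w χ true l) ?_ ?_ l.length
  · refine Runs.mono (Runs.cons (Q := fun s' => s' = s.setReg 22 χ) (Runs.of_wp ?_) fun s1 hs1 =>
      Runs.cons (Q := fun s' => s' = (s.setReg 22 χ).setReg 20 0) (Runs.of_wp ?_) fun s2 hs2 =>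
      Runs.cons (Q := fun s' => s' = ((s.setReg 22 χ).setReg 20 0).setReg 21 0)
        (Runs.of_wp ?_) fun s3 hs3 =>
      Runs.cons (Q := fun s' => s' = (((s.setReg 22 χ).setReg 20 0).setReg 21 0).setReg 23
        (base + l.length)) (Runs.of_wp ?_) fun s4 hs4 =>
      Runs.cons (key s4 ?_) fun s5 hs5 => Runs.nil hs5) ?_ ?_
    · simp [wp, h19]
    · subst hs1; simp [wp]
    · subst hs2; simp [wp]
    · subst hs3; simp [wp, h6, h10, hL]
    · subst hs4
      refine ⟨l, rfl, le_rfl, hst, ?_, ?_, ?_, ?_, ?_, ?_⟩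
      · repeat refine Frame.setReg ?_ (by norm_num)
        exact Frame.refl _ _
      all_goals simp [Nat.mod_eq_of_lt hχ]
    · simp only [Prog.length]; omega
    · rintro s' ⟨l', hl', -, -, hf, hm, -, -, h20, h21⟩
      rw [List.length_eq_zero_iff] at hl'
      subst hl'
      exact ⟨hf, hm, h20, h21⟩
  · rintro s' ⟨l', -, -, -, hf, -, h23, -⟩
    rw [h23, hf 6 (by norm_num), h6]
    omega
  · rintro m s' ⟨l', hl', hml, hst', hf, hm, h23, h22, h20, h21⟩
    cases l' with
    | nil => simp at hl'
    | cons v l' =>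
      rw [List.length_cons] at hl'
      obtain rfl : l'.length = m := by omega
      have e3 : s'.reg 3 = 1 := by rw [hf 3 (by norm_num), h3]
      have e6 : s'.reg 6 = base := by rw [hf 6 (by norm_num), h6]
      have e12 : s'.reg 12 = w := by rw [hf 12 (by norm_num), h12]
      have e14 : s'.reg 14 = 2 ^ l.length := by rw [hf 14 (by norm_num), h14]
      have hds := double_shift (χ := χ) hml
      have hlt := mod_shift_lt (χ := χ) (m := l'.length) (d := l.length) (by omega)
      have hlt' := mod_shift_lt (χ := χ) (m := l'.length + 1) (d := l.length) hml
      have hrow := row_add_lt v w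
      have hsub : base + (l'.length + 1) - 1 = base + l'.length := by omega
      classical
      have ha : s.mem (v * n + w) = if G.Adj w v then 1 else 0 := by
        rw [hadj v w, if_congr (G.adj_comm v w) rfl rfl]
      have hc0 := nbrCount_le_length G w χ false l
      have hc1 := nbrCount_le_length G w χ true l
      simp only [nbrCount] at h20 h21
      refine ⟨by omega, Runs.mono (T := Prog.length _) (Runs.of_wp ?_)
        (by simp [block, Prog.length]) fun _ => id⟩
      simp only [block, wp, State.setReg_reg, State.setReg_mem, ↓reduceIte, Nat.reduceEqDiff,
        hm, e3, e12, e14, h23, h22, hsub, hst'.1, ha]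
      refine ⟨by omega, by omega, fun hlow => ?_, fun hhigh => ?_⟩
      · -- no carry: the digit is `0`
        have hb : χ.testBit l'.length = false := by
          by_contra hb
          rw [Bool.not_eq_false] at hb
          rw [if_pos hb] at hds
          omega
        simp only [hb] at hds h20 h21
        norm_num at hds h20 h21
        refine ⟨by split_ifs at * <;> omega, l', rfl, by omega, hst'.2, ?_, trivial, trivial,
          by omega, by omega, h21⟩
        repeat refine Frame.setReg ?_ (by norm_num)
        exact hf
      · have hb : χ.testBit l'.length = true := by
          by_contra hb
          rw [if_neg hb] at hds
          omega
        simp only [hb] at hds h20 h21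
        norm_num at hds h20 h21
        refine ⟨by split_ifs at * <;> omega, l', rfl, by omega, hst'.2, ?_, trivial, trivial,
          by omega, h20, by omega⟩
        repeat refine Frame.setReg ?_ (by norm_num)
        exact hf

/-! ### Extending the table by a new vertex -/

/-- One row of the table (at `R₁₇`) yields two rows for the search path with a new vertex: a row at
`R₁₈` for the color blue, which adds `R₂₀` blue edges, and a row `R₁₅` cells further on for the
color red, which adds `R₂₁` red edges. -/
def rowProg : Prog :=
  forLt 22 4 (block [.add 23 17 22, .load 23 23, .ifLt 2 23 (.add 23 23 20) .skip, .add 24 18 22,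
    .store 24 23, .sub 23 22 21, .add 23 17 23, .load 23 23, .add 24 24 15, .store 24 23])

lemma runs_rowProg {L W PW p q a0 a1 : ℕ} {s : State} (h2 : s.reg 2 = 0) (h3 : s.reg 3 = 1)
    (h4 : s.reg 4 = W) (h15 : s.reg 15 = PW) (h17 : s.reg 17 = p) (h18 : s.reg 18 = q)
    (h20 : s.reg 20 = a0) (h21 : s.reg 21 = a1) (hpq : p + W ≤ q) (hW : W ≤ PW)
    (hL : q + PW + W < 2 ^ L) (hv : ∀ r < W, s.mem (p + r) + a0 < 2 ^ L) :
    Runs L rowProg s (15 * W + 2) fun s' => Frame 22 s s' ∧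
      (∀ r < W, s'.mem (q + r) = if 0 < s.mem (p + r) then s.mem (p + r) + a0 else 0) ∧
      (∀ r < W, s'.mem (q + PW + r) = s.mem (p + (r - a1))) ∧
      ∀ a, ¬ (q ≤ a ∧ a < q + W) → ¬ (q + PW ≤ a ∧ a < q + PW + W) → s'.mem a = s.mem a := by
  refine Runs.mono (Runs.forLt (N := W) (T := 13) (fun m s' => Frame 22 s s' ∧
      (∀ r < m, s'.mem (q + r) = if 0 < s.mem (p + r) then s.mem (p + r) + a0 else 0) ∧
      (∀ r < m, s'.mem (q + PW + r) = s.mem (p + (r - a1))) ∧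
      ∀ a, ¬ (q ≤ a ∧ a < q + m) → ¬ (q + PW ≤ a ∧ a < q + PW + m) → s'.mem a = s.mem a)
      ?_ ?_ ?_) ?_ fun s' h => h
  · intro m s' _ h; rw [h.1 4 (by norm_num), h4]
  · refine ⟨?_, by simp, by simp, by simp⟩
    exact (Frame.refl 22 s).setReg (by norm_num)
  · rintro m s' hm hi ⟨hf, hblue, hred, hother⟩
    have e2 : s'.reg 2 = 0 := by rw [hf 2 (by norm_num), h2]
    have e3 : s'.reg 3 = 1 := by rw [hf 3 (by norm_num), h3]
    have e15 : s'.reg 15 = PW := by rw [hf 15 (by norm_num), h15]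
    have e17 : s'.reg 17 = p := by rw [hf 17 (by norm_num), h17]
    have e18 : s'.reg 18 = q := by rw [hf 18 (by norm_num), h18]
    have e20 : s'.reg 20 = a0 := by rw [hf 20 (by norm_num), h20]
    have e21 : s'.reg 21 = a1 := by rw [hf 21 (by norm_num), h21]
    have hpm : s'.mem (p + m) = s.mem (p + m) := hother _ (by omega) (by omega)
    have hpr : s'.mem (p + (m - a1)) = s.mem (p + (m - a1)) := hother _ (by omega) (by omega)
    have hvm := hv m hm
    have hne : p + (m - a1) ≠ q + m := by omega
    refine Runs.of_wp ?_
    simp only [block, wp, State.setReg_reg, State.setReg_mem, State.setMem_reg, State.setMem_mem,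
      ↓reduceIte, Nat.reduceEqDiff, hi, e2, e3, e15, e17, e18, e20, e21, hpm, hpr, if_neg hne]
    refine ⟨by omega, fun hpos => ⟨by omega, by omega, by omega, by omega, trivial, trivial, ?_, ?_,
      ?_, ?_⟩, fun hzero => ⟨by omega, by omega, by omega, trivial, trivial, ?_, ?_, ?_, ?_⟩⟩
    all_goals try (repeat first | exact hf | refine Frame.setMem ?_ |
      refine Frame.setReg ?_ (by norm_num))
    · intro r hr
      rw [if_neg (by omega)]
      split_ifs with h1 h2 h3
      · rw [show r = m by omega]
      · rw [show r = m by omega] at h2; omega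
      · rw [hblue r (by omega), if_pos h3]
      · rw [hblue r (by omega), if_neg h3]
    · intro r hr
      split_ifs with h1 h2
      · rw [show r = m by omega]
      · omega
      · exact hred r (by omega)
    · intro a ha hb
      rw [if_neg (by omega), if_neg (by omega)]
      exact hother a (by omega) (by omega)
    · intro r hr
      rw [if_neg (by omega)]
      split_ifs with h1 h2 h3
      · rw [show r = m by omega] at h2; omega
      · omega
      · rw [hblue r (by omega), if_pos h3]
      · rw [hblue r (by omega), if_neg h3]
    · intro r hr
      split_ifs with h1 h2
      · rw [show r = m by omega]
      · omega
      · exact hred r (by omega)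
    · intro a ha hb
      rw [if_neg (by omega), if_neg (by omega)]
      exact hother a (by omega) (by omega)
  · omega

/-- The new table for the search path extended by the vertex in register `12`. The table starts at
`R₁₇`, the new one at `R₁₈ = R₁₇ + R₁₅`. -/
def extendProg : Prog :=
  forLt 19 14 (block [countProg, rowProg, .add 17 17 4, .add 18 18 4])

lemma runs_extendProg {L n base W p : ℕ} {G : SimpleGraph (Fin n)} {l : List (Fin n)} {w : Fin n}
    {s : State} (h2 : s.reg 2 = 0) (h3 : s.reg 3 = 1) (h4 : s.reg 4 = W) (h6 : s.reg 6 = base)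
    (h10 : s.reg 10 = l.length) (h12 : s.reg 12 = w) (h14 : s.reg 14 = 2 ^ l.length)
    (h15 : s.reg 15 = 2 ^ l.length * W) (h17 : s.reg 17 = p)
    (h18 : s.reg 18 = p + 2 ^ l.length * W)
    (hadj : AdjAt G s.mem) (hst : StackAt s.mem base l) (hW : 0 < W)
    (hbase : n * n ≤ base) (hp : base + l.length ≤ p) (hL : p + 3 * (2 ^ l.length * W) < 2 ^ L)
    (hv : ∀ a, p ≤ a → a < p + 2 ^ l.length * W → s.mem a + l.length < 2 ^ L) :
    Runs L extendProg s (2 + 2 ^ l.length * (12 * l.length + 15 * W + 13)) fun s' =>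
      Frame 17 s s' ∧ (∀ a < p + 2 ^ l.length * W, s'.mem a = s.mem a) ∧
      (∀ χ < 2 ^ l.length, ∀ r < W, s'.mem (p + 2 ^ l.length * W + χ * W + r) =
        if 0 < s.mem (p + χ * W + r) then s.mem (p + χ * W + r) + nbrCount G w χ false l else 0) ∧
      ∀ χ < 2 ^ l.length, ∀ r < W,
        s'.mem (p + 2 ^ l.length * W + (2 ^ l.length + χ) * W + r) =
          s.mem (p + χ * W + (r - nbrCount G w χ true l)) := by
  generalize hPW : 2 ^ l.length * W = PW at *
  have hP : 2 ^ l.length ≤ PW := hPW ▸ Nat.le_mul_of_pos_right _ hW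
  have h2P := Nat.two_pow_pos l.length
  have hWP : W ≤ PW := hPW ▸ Nat.le_mul_of_pos_left _ h2P
  have hrowlt : ∀ {χ}, χ < 2 ^ l.length → χ * W + W ≤ PW := fun {χ} hχ => by
    have := Nat.mul_le_mul_right W (Nat.succ_le_of_lt hχ)
    rwa [Nat.succ_mul, hPW] at this
  have hrow : ∀ {χ m}, χ < m → χ * W + W ≤ m * W := fun {χ m} hχ => by
    have := Nat.mul_le_mul_right W (Nat.succ_le_of_lt hχ)
    rwa [Nat.succ_mul] at this
  refine Runs.mono (Runs.forLt (N := 2 ^ l.length) (T := 12 * l.length + 15 * W + 11)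
    (fun m s' => Frame 17 s s' ∧ (∀ a < p + PW, s'.mem a = s.mem a) ∧
      s'.reg 17 = p + m * W ∧ s'.reg 18 = p + PW + m * W ∧
      (∀ χ < m, ∀ r < W, s'.mem (p + PW + χ * W + r) =
        if 0 < s.mem (p + χ * W + r) then s.mem (p + χ * W + r) + nbrCount G w χ false l else 0) ∧
      ∀ χ < m, ∀ r < W, s'.mem (p + PW + PW + χ * W + r) =
        s.mem (p + χ * W + (r - nbrCount G w χ true l)))
      ?_ ?_ ?_) ?_ ?_
  · intro m s' _ h; rw [h.1 14 (by norm_num), h14]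
  · refine ⟨(Frame.refl 17 s).setReg (by norm_num), ?_⟩
    simp [h17, h18]
  · rintro m s' hm hi ⟨hf, hlow, e17, e18, hblue, hred⟩
    have hmW := hrowlt hm
    refine Runs.mono (Runs.cons (runs_countProg (G := G) (base := base) (w := w) (l := l)
      (by rw [hf 3 (by norm_num), h3]) (by rw [hf 6 (by norm_num), h6])
      (by rw [hf 10 (by norm_num), h10]) (by rw [hf 12 (by norm_num), h12])
      (by rw [hf 14 (by norm_num), h14]) hi hm ?_ ?_ hbase (by omega) (by omega))
      fun s1 hs1 => Runs.cons (runs_rowProg (W := W) (PW := PW) (p := p + m * W)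
        (q := p + PW + m * W) (a0 := nbrCount G w m false l) (a1 := nbrCount G w m true l)
        ?_ ?_ ?_ ?_ ?_ ?_ hs1.2.2.1 hs1.2.2.2 (by omega) hWP (by omega) ?_)
      fun s2 hs2 => Runs.of_wp ?_) (by simp [block, Prog.length]; omega) fun _ h => h
    · intro u v
      rw [hlow _ (by have := row_add_lt u v; omega), hadj]
    · exact hst.congr fun i hi => hlow _ (by omega)
    · rw [hs1.1 2 (by norm_num), hf 2 (by norm_num), h2]
    · rw [hs1.1 3 (by norm_num), hf 3 (by norm_num), h3]
    · rw [hs1.1 4 (by norm_num), hf 4 (by norm_num), h4]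
    · rw [hs1.1 15 (by norm_num), hf 15 (by norm_num), h15]
    · rw [hs1.1 17 (by norm_num), e17]
    · rw [hs1.1 18 (by norm_num), e18]
    · intro r hr
      rw [hs1.2.1, hlow _ (by omega)]
      have := hv (p + m * W + r) (by omega) (by omega)
      have := nbrCount_le_length G w m false l
      omega
    · obtain ⟨hf1, hm1, -, -⟩ := hs1
      obtain ⟨hf2, hblue2, hred2, hother⟩ := hs2
      have hf12 : Frame 17 s s2 :=
        (hf.trans (hf1.mono (by norm_num))).trans (hf2.mono (by norm_num))
      have g4 : s2.reg 4 = W := by rw [hf12 4 (by norm_num), h4]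
      have g3 : s2.reg 3 = 1 := by rw [hf12 3 (by norm_num), h3]
      have g17 : s2.reg 17 = p + m * W := by
        rw [hf2 17 (by norm_num), hf1 17 (by norm_num), e17]
      have g18 : s2.reg 18 = p + PW + m * W := by
        rw [hf2 18 (by norm_num), hf1 18 (by norm_num), e18]
      have g19 : s2.reg 19 = m := by rw [hf2 19 (by norm_num), hf1 19 (by norm_num), hi]
      have hs : (m + 1) * W = m * W + W := Nat.succ_mul m W
      simp only [block, wp, State.setReg_reg, State.setReg_mem, ↓reduceIte, Nat.reduceEqDiff,
        g3, g4, g17, g18, g19, hs]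
      rw [hm1] at hblue2 hred2 hother
      refine ⟨by omega, by omega, trivial, trivial, ?_, ?_, by omega, by omega, ?_, ?_⟩
      · repeat refine Frame.setReg ?_ (by norm_num)
        exact hf12
      · intro a ha
        rw [hother a (by omega) (by omega), hlow a ha]
      · intro χ hχ r hr
        rcases Nat.lt_succ_iff_lt_or_eq.1 hχ with hχ | rfl
        · have := hrow hχ
          rw [hother _ (by omega) (by omega), hblue χ hχ r hr]
        · rw [hblue2 r hr, hlow _ (by omega)]
      · intro χ hχ r hr
        rcases Nat.lt_succ_iff_lt_or_eq.1 hχ with hχ | rfl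
        · have := hrow hχ
          rw [hother _ (by omega) (by omega), hred χ hχ r hr]
        · rw [show p + PW + PW + χ * W + r = p + PW + χ * W + PW + r by omega, hred2 r hr,
            hlow _ (by omega)]
  · exact (by ring : _ = _).le
  · rintro s' ⟨hf, hlow, -, -, hblue, hred⟩
    refine ⟨hf, hlow, hblue, fun χ hχ r hr => ?_⟩
    rw [Nat.add_mul, hPW, ← hred χ hχ r hr]
    congr 1
    omega

/-! ### One step of the depth-first search -/

/-- The contents of the registers that have a fixed meaning: `0` and `1` are the input, `5`, `6`
and `7` the addresses of the marks of the discovered vertices, of the search path and of the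
tables, `8` the length of the search path that ends the search, `9` the number of steps, and `10`
the length `d` of the search path. -/
structure Registers (n k d : ℕ) (s : State) : Prop where
  r0 : s.reg 0 = n
  r1 : s.reg 1 = k
  r2 : s.reg 2 = 0
  r3 : s.reg 3 = 1
  r4 : s.reg 4 = k + 1
  r5 : s.reg 5 = n * n
  r6 : s.reg 6 = n * n + n
  r7 : s.reg 7 = n * n + 2 * n
  r8 : s.reg 8 = 2 * k + 2
  r9 : s.reg 9 = 2 * n
  r10 : s.reg 10 = d

lemma Registers.frame {n k d : ℕ} {s s' : State} (h : Registers n k d s) (hf : Frame 11 s s') :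
    Registers n k d s' := by
  obtain ⟨r0, r1, r2, r3, r4, r5, r6, r7, r8, r9, r10⟩ := h
  constructor <;> rw [hf _ (by norm_num)] <;> assumption

/-- The table of the search path `l` is stored from address `p` on: the entry `r` of row `χ` is `0`
if the coloring `χ` of `l` does not extend to one with at least `r` red edges inside `S`, and
otherwise exceeds by one the largest number of blue edges inside `S` in such an extension. -/
def TableAt {n : ℕ} (G : SimpleGraph (Fin n)) (k : ℕ) (S : Finset (Fin n)) (l : List (Fin n))
    (mem : ℕ → ℕ) (p : ℕ) : Prop :=
  ∀ χ < 2 ^ l.length, ∀ r < k + 1, ∀ b, b < mem (p + χ * (k + 1) + r) ↔ Feasible G l S χ r b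

lemma TableAt.le {n k p a : ℕ} {G : SimpleGraph (Fin n)} {S : Finset (Fin n)} {l : List (Fin n)}
    {mem : ℕ → ℕ} (h : TableAt G k S l mem p) (ha : p ≤ a) (ha' : a < p + 2 ^ l.length * (k + 1)) :
    mem a ≤ n * n + 1 := by
  by_contra! hlt
  obtain ⟨i, rfl⟩ := Nat.exists_eq_add_of_le ha
  have hdiv : i / (k + 1) < 2 ^ l.length := Nat.div_lt_of_lt_mul (by rw [mul_comm]; omega)
  have := h _ hdiv _ (Nat.mod_lt i k.succ_pos) (n * n + 1)
  have he : p + i / (k + 1) * (k + 1) + i % (k + 1) = p + i := by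
    rw [add_assoc, mul_comm, Nat.div_add_mod]
  rw [he] at this
  have := (this.1 hlt).le_card
  simp at this

/-- The machine state represents the state `(S, l)` of the search, together with its table. -/
structure Represents {n : ℕ} (G : SimpleGraph (Fin n)) (k : ℕ) (S : Finset (Fin n))
    (l : List (Fin n)) (s : State) : Prop where
  registers : Registers n k l.length s
  search : SearchState G S l
  adj : AdjAt G s.mem
  marks : ∀ v : Fin n, s.mem (n * n + v) = if v ∈ S then 1 else 0
  stack : StackAt s.mem (n * n + n) l
  table : TableAt G k S l s.mem (n * n + 2 * n + 2 ^ l.length * (k + 1))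

lemma Represents.frame {n k : ℕ} {G : SimpleGraph (Fin n)} {S : Finset (Fin n)}
    {l : List (Fin n)} {s s' : State} (h : Represents G k S l s) (hf : Frame 11 s s')
    (hm : s'.mem = s.mem) : Represents G k S l s' := by
  obtain ⟨h1, h2, h3, h4, h5, h6⟩ := h
  exact ⟨h1.frame hf, h2, hm ▸ h3, hm ▸ h4, hm ▸ h5, hm ▸ h6⟩

/-- The search can proceed to `w`: it is undiscovered and adjacent to the current vertex, or there
is no current vertex. -/
def IsNext {n : ℕ} (G : SimpleGraph (Fin n)) (S : Finset (Fin n)) (l : List (Fin n))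
    (w : Fin n) : Prop :=
  w ∉ S ∧ ∀ v ∈ l.head?, G.Adj v w

/-- `R₁₂` becomes a vertex to which the search can proceed, and `R₁₃` the address of its row of
the adjacency matrix; `R₁₂ = n` if there is no such vertex. For an empty search path, the address
loaded into `R₁₄` has no meaning and is not used. -/
def findProg : Prog :=
  block [block [.copy 12 0, .sub 14 10 3, .add 14 14 6, .load 14 14, .const 16 0],
    forLt 15 0 (block [.add 17 5 15, .load 17 17,
      .ifLt 17 3
        (block [.copy 18 3, .ifLt 2 10 (block [.add 18 14 15, .load 18 18]) .skip,
          .ifLt 2 18 (block [.copy 12 15, .copy 13 16]) .skip])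
        .skip,
      .add 16 16 0])]

lemma runs_findProg {L n k : ℕ} {G : SimpleGraph (Fin n)} {S : Finset (Fin n)} {l : List (Fin n)}
    {s : State} (h : Represents G k S l s) (hL : n * n + 2 * n + 8 < 2 ^ L) :
    Runs L findProg s (20 * n + 9) fun s' => Frame 12 s s' ∧ s'.mem = s.mem ∧
      ((s'.reg 12 = n ∧ ∀ w, ¬ IsNext G S l w) ∨
        ∃ w : Fin n, s'.reg 12 = w ∧ s'.reg 13 = w * n ∧ IsNext G S l w) := by
  obtain ⟨hreg, hsearch, hadj, hmarks, hstack, -⟩ := h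
  obtain ⟨r0, -, r2, r3, -, r5, r6, -, -, -, r10⟩ := hreg
  have hlen : l.length ≤ n := by
    have := hsearch.length_le.trans S.card_le_univ
    simpa using this
  refine Runs.mono (Runs.cons (Q := fun s' => Frame 12 s s' ∧ s'.mem = s.mem ∧ s'.reg 12 = n ∧
      s'.reg 16 = 0 ∧ ∀ v ∈ l.head?, s'.reg 14 = v * n) (Runs.of_wp ?_) fun s1 hs1 => Runs.cons
    (Runs.forLt (N := n) (T := 18) (fun m s' => Frame 12 s s' ∧ s'.mem = s.mem ∧
      s'.reg 16 = m * n ∧ (∀ v ∈ l.head?, s'.reg 14 = v * n) ∧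
      ((s'.reg 12 = n ∧ ∀ w : Fin n, (w : ℕ) < m → ¬ IsNext G S l w) ∨
        ∃ w : Fin n, s'.reg 12 = w ∧ s'.reg 13 = w * n ∧ IsNext G S l w)) ?_ ?_ ?_)
    fun s2 hs2 => Runs.nil hs2) ?_ ?_
  · simp only [block, wp, State.setReg_reg, State.setReg_mem, ↓reduceIte, Nat.reduceEqDiff,
      r0, r3, r6, r10]
    refine ⟨by omega, by omega, ?_, trivial, trivial, trivial, ?_⟩
    · repeat refine Frame.setReg ?_ (by norm_num)
      exact Frame.refl _ _
    · intro v hv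
      cases l with
      | nil => simp at hv
      | cons u l =>
        obtain rfl : u = v := by simpa using hv
        rw [List.length_cons, Nat.add_sub_cancel, add_comm, hstack.1]
  · intro m s' _ h; rw [h.1 0 (by norm_num), r0]
  · obtain ⟨hf, hm, h12, h16, h14⟩ := hs1
    refine ⟨hf.setReg (by norm_num), hm, by simpa using h16, by simpa using h14, Or.inl ⟨by
      simpa using h12, by simp⟩⟩
  · rintro m s' hmn hi ⟨hf, hm, h16, h14, h12⟩
    have e0 : s'.reg 0 = n := by rw [hf 0 (by norm_num), r0]
    have e2 : s'.reg 2 = 0 := by rw [hf 2 (by norm_num), r2]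
    have e3 : s'.reg 3 = 1 := by rw [hf 3 (by norm_num), r3]
    have e5 : s'.reg 5 = n * n := by rw [hf 5 (by norm_num), r5]
    have e10 : s'.reg 10 = l.length := by rw [hf 10 (by norm_num), r10]
    obtain ⟨w, rfl⟩ : ∃ w : Fin n, (w : ℕ) = m := ⟨⟨m, hmn⟩, rfl⟩
    have hw := hmarks w
    have hrow := row_add_lt w w
    have hwn : ((w : ℕ) + 1) * n = w * n + n := Nat.succ_mul _ _
    -- the two ways in which a round of the loop can end
    have hnext : IsNext G S l w →
        (((w : ℕ) = n ∧ ∀ u : Fin n, (u : ℕ) < w + 1 → ¬ IsNext G S l u) ∨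
        ∃ u : Fin n, (w : ℕ) = u ∧ (w : ℕ) * n = u * n ∧ IsNext G S l u) :=
      fun h => Or.inr ⟨w, rfl, rfl, h⟩
    have hskip : ¬ IsNext G S l w →
        ((s'.reg 12 = n ∧ ∀ u : Fin n, (u : ℕ) < w + 1 → ¬ IsNext G S l u) ∨
        ∃ u : Fin n, s'.reg 12 = u ∧ s'.reg 13 = u * n ∧ IsNext G S l u) := by
      intro h
      refine h12.imp_left fun h' => ⟨h'.1, fun u hu => ?_⟩
      rcases Nat.lt_succ_iff_lt_or_eq.1 hu with hu | hu
      · exact h'.2 u hu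
      · rwa [Fin.ext hu]
    refine Runs.of_wp ?_
    simp only [block, wp, State.setReg_reg, State.setReg_mem, ↓reduceIte, Nat.reduceEqDiff, hi,
      e0, e2, e3, e5, e10, hm, h16, hw, hwn]
    have hb1 : n * n + (w : ℕ) < 2 ^ L := by omega
    have hb2 : (w : ℕ) * n + n < 2 ^ L := by omega
    -- the entry of the adjacency matrix that is inspected if there is a current vertex
    have hedge : 0 < l.length → s'.reg 14 + w < 2 ^ L ∧
        (0 < s.mem (s'.reg 14 + w) ↔ ∀ v ∈ l.head?, G.Adj v w) := by
      intro hpos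
      cases l with
      | nil => simp at hpos
      | cons v l =>
        have := row_add_lt v w
        rw [h14 v (by simp), hadj v w]
        exact ⟨by omega, by split_ifs with h <;> simp [h]⟩
    have hnil : l.length ≤ 0 → ∀ v ∈ l.head?, G.Adj v w := by
      intro h0
      rw [List.length_eq_zero_iff.1 (Nat.le_zero.1 h0)]
      simp
    refine ⟨hb1, fun h1 => ?_, fun h1 => ⟨hb2, trivial, trivial, ?_, trivial, trivial, h14,
      hskip fun h => ?_⟩⟩
    · have hS : w ∉ S := fun h => by simp [h] at h1
      refine ⟨fun hpos => ⟨(hedge hpos).1,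
        fun h0 => ⟨hb2, trivial, trivial, ?_, trivial, trivial, h14,
          hnext ⟨hS, (hedge hpos).2.1 h0⟩⟩,
        fun h0 => ⟨hb2, trivial, trivial, ?_, trivial, trivial, h14,
          hskip fun h => h0.not_gt ((hedge hpos).2.2 h.2)⟩⟩,
        fun hz => ⟨fun h0 => ⟨hb2, trivial, trivial, ?_, trivial, trivial, h14,
          hnext ⟨hS, hnil hz⟩⟩, fun h0 => absurd h0 (by norm_num)⟩⟩
      all_goals
        repeat refine Frame.setReg ?_ (by norm_num)
        exact hf
    · repeat refine Frame.setReg ?_ (by norm_num)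
      exact hf
    · rw [if_neg h.1] at h1
      omega
  · simp [block, Prog.length]; omega
  · rintro s' ⟨hf, hm, -, -, h12⟩
    exact ⟨hf, hm, h12.imp_left fun h => ⟨h.1, fun w => h.2 w w.2⟩⟩

/-- The search proceeds to the vertex in register `12`, the address of whose row of the adjacency
matrix is in register `13`. -/
def pushProg : Prog :=
  block [powProg, block [.add 17 7 15, .add 18 17 15], extendProg,
    block [.add 16 5 12, .store 16 3, .add 16 6 10, .store 16 13, .add 10 10 3]]

lemma runs_pushProg {L n k : ℕ} {G : SimpleGraph (Fin n)} {S : Finset (Fin n)} {l : List (Fin n)}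
    {w : Fin n} {s : State} (h : Represents G k S l s) (hw : IsNext G S l w) (h12 : s.reg 12 = w)
    (h13 : s.reg 13 = w * n)
    (hL : n * n + 2 * n + 4 * (2 ^ l.length * (k + 1)) < 2 ^ L) :
    Runs L pushProg s (17 * l.length + 17 + 2 ^ l.length * (12 * l.length + 15 * k + 28)) fun s' =>
      Frame 10 s s' ∧ s'.reg 11 = s.reg 11 ∧ Represents G k (insert w S) (w :: l) s' := by
  obtain ⟨⟨r0, r1, r2, r3, r4, r5, r6, r7, r8, r9, r10⟩, hsearch, hadj, hmarks, hstack, htable⟩ := h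
  have hlen : l.length < n := by
    have h1 := hsearch.length_le
    have h2 : S.card < (insert w S).card := by rw [Finset.card_insert_of_notMem hw.1]; omega
    have h3 := (insert w S).card_le_univ
    rw [Fintype.card_fin] at h3
    omega
  have h2P := Nat.two_pow_pos l.length
  have hP : 2 ^ l.length ≤ 2 ^ l.length * (k + 1) := Nat.le_mul_of_pos_right _ k.succ_pos
  have htable_le := fun a => htable.le (a := a)
  generalize hPW : 2 ^ l.length * (k + 1) = PW at *
  refine Runs.mono (Runs.cons (runs_powProg r3 r4 r10 (by omega) (by omega)) fun s1 hs1 =>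
    Runs.cons (Q := fun s2 => Frame 14 s s2 ∧ s2.mem = s.mem ∧ s2.reg 14 = 2 ^ l.length ∧
      s2.reg 15 = PW ∧ s2.reg 17 = n * n + 2 * n + PW ∧ s2.reg 18 = n * n + 2 * n + PW + PW)
      (Runs.of_wp ?_) fun s2 hs2 => Runs.cons (runs_extendProg (G := G) (base := n * n + n)
        (w := w) (l := l) (p := n * n + 2 * n + PW) (W := k + 1) ?_ ?_ ?_ ?_ ?_ ?_ hs2.2.2.1 ?_
        hs2.2.2.2.2.1 ?_ ?_ ?_ k.succ_pos (by omega) (by omega) (by omega) ?_) fun s3 hs3 =>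
    Runs.cons (Runs.of_wp ?_) fun s4 hs4 => Runs.nil hs4) ?_ fun _ h => h
  · obtain ⟨hf, hm, h14, h15⟩ := hs1
    rw [hPW] at h15
    have e7 : s1.reg 7 = n * n + 2 * n := by rw [hf 7 (by norm_num), r7]
    simp only [block, wp, State.setReg_reg, State.setReg_mem, ↓reduceIte, Nat.reduceEqDiff,
      e7, h14, h15, hm]
    refine ⟨by omega, by omega, ?_, trivial, trivial, trivial, trivial, trivial⟩
    repeat refine Frame.setReg ?_ (by norm_num)
    exact hf
  · rw [hs2.1 2 (by norm_num), r2]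
  · rw [hs2.1 3 (by norm_num), r3]
  · rw [hs2.1 4 (by norm_num), r4]
  · rw [hs2.1 6 (by norm_num), r6]
  · rw [hs2.1 10 (by norm_num), r10]
  · rw [hs2.1 12 (by norm_num), h12]
  · rw [hPW]; exact hs2.2.2.2.1
  · rw [hPW]; exact hs2.2.2.2.2.2
  · rw [hs2.2.1]; exact hadj
  · rw [hs2.2.1]; exact hstack
  · intro a ha hb
    rw [hs2.2.1]
    have := htable_le a ha (by omega)
    omega
  · obtain ⟨hf2, hm2, -⟩ := hs2
    obtain ⟨hf3, hlow, hblue, hred⟩ := hs3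
    rw [hPW] at hlow hblue
    rw [hm2] at hlow hblue hred
    simp only [hPW] at hred
    have hf : Frame 14 s s3 := hf2.trans (hf3.mono (by norm_num))
    have e3 : s3.reg 3 = 1 := by rw [hf 3 (by norm_num), r3]
    have e5 : s3.reg 5 = n * n := by rw [hf 5 (by norm_num), r5]
    have e6 : s3.reg 6 = n * n + n := by rw [hf 6 (by norm_num), r6]
    have e10 : s3.reg 10 = l.length := by rw [hf 10 (by norm_num), r10]
    have e11 : s3.reg 11 = s.reg 11 := by rw [hf 11 (by norm_num)]
    have e12 : s3.reg 12 = w := by rw [hf 12 (by norm_num), h12]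
    have e13 : s3.reg 13 = w * n := by rw [hf 13 (by norm_num), h13]
    have hwn := w.2
    simp only [block, wp, State.setReg_reg, State.setMem_reg, ↓reduceIte, Nat.reduceEqDiff,
      e3, e5, e6, e10, e11, e12, e13]
    refine ⟨by omega, by omega, by omega, ?_, trivial, ?_⟩
    · repeat first | refine Frame.setMem ?_ | refine Frame.setReg ?_ (by norm_num)
      exact hf.mono (by norm_num)
    have hPW' : 2 ^ (w :: l).length * (k + 1) = PW + PW := by
      rw [List.length_cons, pow_succ, mul_assoc, mul_comm 2, ← mul_assoc, hPW]; ring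
    refine ⟨?_, hsearch.push hw.1 hw.2, ?_, ?_, ?_, ?_⟩
    · constructor <;> simp only [State.setReg_reg, State.setMem_reg, ↓reduceIte, Nat.reduceEqDiff,
        List.length_cons]
      all_goals rw [hf _ (by norm_num)]; assumption
    · intro u v
      have := row_add_lt u v
      simp only [State.setReg_mem, State.setMem_mem]
      rw [if_neg (by omega), if_neg (by omega), hlow _ (by omega), hadj]
    · intro v
      have := v.2
      simp only [State.setReg_mem, State.setMem_mem]
      rw [if_neg (by omega), hlow _ (by omega), hmarks v]
      by_cases hvw : v = w
      · simp [hvw]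
      · have : (v : ℕ) ≠ w := fun h => hvw (Fin.ext h)
        simp [hvw, this]
    · refine ⟨by simp, hstack.congr fun i hi => ?_⟩
      simp only [State.setReg_mem, State.setMem_mem]
      rw [if_neg (by omega), if_neg (by omega), hlow _ (by omega)]
    · intro χ hχ r hr b
      rw [hPW']
      simp only [State.setReg_mem, State.setMem_mem]
      rw [if_neg (by omega), if_neg (by omega), ← add_assoc (n * n + 2 * n)]
      rcases Nat.lt_or_ge χ (2 ^ l.length) with hlt | hge
      · rw [hblue χ hlt r hr, hsearch.feasible_blue hw.1 hlt, ← htable χ hlt r hr]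
        split_ifs <;> omega
      · obtain ⟨χ, rfl⟩ := Nat.exists_eq_add_of_le hge
        have hlt : χ < 2 ^ l.length := by
          rw [List.length_cons, pow_succ] at hχ
          omega
        rw [hred χ hlt r hr, hsearch.feasible_red hw.1 hlt, ← htable χ hlt _ (by omega)]
  · simp only [block, Prog.length]
    have : 12 * l.length + 15 * (k + 1) + 13 = 12 * l.length + 15 * k + 28 := by ring
    rw [this]
    omega

/-- The search returns from the current vertex to its predecessor on the search path. The table
becomes the entrywise maximum of its two halves, in which the vertex left is blue and red. -/
def popProg : Prog :=
  block [.sub 10 10 3, powProg, block [.add 17 7 15, .add 18 17 15, .add 19 18 15],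
    forLt 20 15 (block [.add 21 18 20, .load 21 21, .add 22 19 20, .load 22 22,
      .ifLt 21 22 (.copy 21 22) .skip, .add 22 17 20, .store 22 21])]

lemma runs_popProg {L n k : ℕ} {G : SimpleGraph (Fin n)} {S : Finset (Fin n)} {l : List (Fin n)}
    {v : Fin n} {s : State} (h : Represents G k S (v :: l) s) (hv : ∀ w, G.Adj v w → w ∈ S)
    (hL : n * n + 2 * n + 4 * (2 ^ l.length * (k + 1)) < 2 ^ L) :
    Runs L popProg s (5 * l.length + 13 + 2 ^ l.length * (k + 1) * 12) fun s' =>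
      Frame 10 s s' ∧ s'.reg 11 = s.reg 11 ∧ Represents G k S l s' := by
  obtain ⟨⟨r0, r1, r2, r3, r4, r5, r6, r7, r8, r9, r10⟩, hsearch, hadj, hmarks, hstack, htable⟩ := h
  have hlen : l.length < n := by
    have h1 := hsearch.length_le
    have h3 := S.card_le_univ
    rw [Fintype.card_fin] at h3
    rw [List.length_cons] at h1
    omega
  have h2P := Nat.two_pow_pos l.length
  have hP : 2 ^ l.length ≤ 2 ^ l.length * (k + 1) := Nat.le_mul_of_pos_right _ k.succ_pos
  have hPW' : 2 ^ (v :: l).length * (k + 1) =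
      2 ^ l.length * (k + 1) + 2 ^ l.length * (k + 1) := by
    rw [List.length_cons]; ring
  have hrowlt : ∀ {χ}, χ < 2 ^ l.length → χ * (k + 1) + (k + 1) ≤ 2 ^ l.length * (k + 1) :=
    fun {χ} hχ => by
      have := Nat.mul_le_mul_right (k + 1) (Nat.succ_le_of_lt hχ)
      rwa [Nat.succ_mul] at this
  rw [hPW'] at htable
  have hadd : ∀ χ, (2 ^ l.length + χ) * (k + 1) = 2 ^ l.length * (k + 1) + χ * (k + 1) :=
    fun χ => Nat.add_mul _ _ _
  generalize hPW : 2 ^ l.length * (k + 1) = PW at *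
  refine Runs.mono (Runs.cons (Q := fun s1 => s1 = s.setReg 10 l.length) (Runs.of_wp ?_)
    fun s1 hs1 => Runs.cons (runs_powProg (d := l.length) (W := k + 1) ?_ ?_ ?_
      (by omega) (by omega)) fun s2 hs2 =>
    Runs.cons (Q := fun s3 => Frame 14 s1 s3 ∧ s3.mem = s.mem ∧ s3.reg 15 = PW ∧
      s3.reg 17 = n * n + 2 * n + PW ∧ s3.reg 18 = n * n + 2 * n + PW + PW ∧
      s3.reg 19 = n * n + 2 * n + PW + PW + PW) (Runs.of_wp ?_) fun s3 hs3 =>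
    Runs.cons (Runs.forLt (N := PW) (T := 10) (fun m s' => Frame 20 s3 s' ∧
      (∀ i < m, s'.mem (n * n + 2 * n + PW + i) = max (s.mem (n * n + 2 * n + PW + PW + i))
        (s.mem (n * n + 2 * n + PW + PW + PW + i))) ∧
      ∀ a, a < n * n + 2 * n + PW ∨ n * n + 2 * n + PW + m ≤ a → s'.mem a = s.mem a) ?_ ?_ ?_)
    fun s4 hs4 => Runs.nil ?_) ?_ fun _ h => h
  · simp [wp, r10, r3]
  · subst hs1; simpa using r3
  · subst hs1; simpa using r4
  · subst hs1; simp
  · obtain ⟨hf, hm, h14, h15⟩ := hs2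
    rw [hPW] at h15
    have e7 : s2.reg 7 = n * n + 2 * n := by rw [hf 7 (by norm_num), hs1]; simpa using r7
    simp only [block, wp, State.setReg_reg, State.setReg_mem, ↓reduceIte, Nat.reduceEqDiff,
      e7, h15, hm]
    refine ⟨by omega, by omega, by omega, ?_, by rw [hs1, State.setReg_mem], trivial, trivial,
      trivial, trivial⟩
    repeat refine Frame.setReg ?_ (by norm_num)
    exact hf
  · intro m s' _ h; rw [h.1 15 (by norm_num), hs3.2.2.1]
  · exact ⟨(Frame.refl _ _).setReg (by norm_num), by simp, fun a _ => by
      rw [State.setReg_mem, hs3.2.1]⟩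
  · rintro m s' hm hi ⟨hf, hdone, hother⟩
    obtain ⟨hf3, -, -, h17, h18, h19⟩ := hs3
    have e3 : s'.reg 3 = 1 := by
      rw [hf 3 (by norm_num), hf3 3 (by norm_num), hs1]; simpa using r3
    have e17 : s'.reg 17 = n * n + 2 * n + PW := by rw [hf 17 (by norm_num), h17]
    have e18 : s'.reg 18 = n * n + 2 * n + PW + PW := by rw [hf 18 (by norm_num), h18]
    have e19 : s'.reg 19 = n * n + 2 * n + PW + PW + PW := by rw [hf 19 (by norm_num), h19]
    have m1 : s'.mem (n * n + 2 * n + PW + PW + m) = s.mem (n * n + 2 * n + PW + PW + m) :=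
      hother _ (by omega)
    have m2 : s'.mem (n * n + 2 * n + PW + PW + PW + m) =
      s.mem (n * n + 2 * n + PW + PW + PW + m) := hother _ (by omega)
    have hfin : ∀ x, x = max (s.mem (n * n + 2 * n + PW + PW + m))
          (s.mem (n * n + 2 * n + PW + PW + PW + m)) →
        (∀ i < m + 1, (if n * n + 2 * n + PW + i = n * n + 2 * n + PW + m then x else
            s'.mem (n * n + 2 * n + PW + i)) = max (s.mem (n * n + 2 * n + PW + PW + i))
          (s.mem (n * n + 2 * n + PW + PW + PW + i))) ∧
        ∀ a, a < n * n + 2 * n + PW ∨ n * n + 2 * n + PW + (m + 1) ≤ a →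
          (if a = n * n + 2 * n + PW + m then x else s'.mem a) = s.mem a := by
      rintro x rfl
      refine ⟨fun i hi => ?_, fun a ha => ?_⟩
      · split_ifs with h
        · rw [show i = m by omega]
        · exact hdone i (by omega)
      · rw [if_neg (by omega)]
        exact hother a (by omega)
    refine Runs.of_wp ?_
    simp only [block, wp, State.setReg_reg, State.setReg_mem, State.setMem_reg, State.setMem_mem,
      ↓reduceIte, Nat.reduceEqDiff, hi, e3, e17, e18, e19, m1, m2]
    refine ⟨by omega, by omega, fun hlt => ⟨by omega, trivial, trivial, ?_, hfin _ ?_⟩,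
      fun hle => ⟨by omega, trivial, trivial, ?_, hfin _ ?_⟩⟩
    · repeat first | refine Frame.setMem ?_ | refine Frame.setReg ?_ (by norm_num)
      exact hf
    · exact (max_eq_right hlt.le).symm
    · repeat first | refine Frame.setMem ?_ | refine Frame.setReg ?_ (by norm_num)
      exact hf
    · exact (max_eq_left hle).symm
  · obtain ⟨hf4, hdone, hother⟩ := hs4
    have hf : Frame 14 (s.setReg 10 l.length) s4 := by
      rw [← hs1]; exact hs3.1.trans (hf4.mono (by norm_num))
    refine ⟨fun i hi => ?_, ?_, ?_, hsearch.pop hv, ?_, ?_, ?_, ?_⟩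
    · rw [hf i (by omega), State.setReg_reg, if_neg (by omega)]
    · rw [hf 11 (by norm_num)]; simp
    · constructor <;> rw [hf _ (by norm_num)] <;> simp <;> assumption
    · intro x y
      have := row_add_lt x y
      rw [hother _ (by omega), hadj]
    · intro x
      have := x.2
      rw [hother _ (by omega), hmarks]
    · exact hstack.2.congr fun i hi => hother _ (by omega)
    · intro χ hχ r hr b
      have := hrowlt hχ
      have h1 := htable χ (by rw [List.length_cons, pow_succ]; omega) r hr b
      have h2 := htable (2 ^ l.length + χ) (by rw [List.length_cons, pow_succ]; omega) r hr b
      rw [hadd] at h2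
      rw [hPW, add_assoc _ (χ * (k + 1)), hdone _ (by omega), lt_max_iff,
        feasible_pop (v := v) hχ, ← h1, ← h2]
      ring_nf
  · simp only [block, Prog.length]
    omega

/-- One step of the search: proceed to a new vertex if possible, and return to the predecessor of
the current vertex otherwise. -/
def stepProg : Prog :=
  block [findProg, .ifLt 12 0 pushProg (.ifLt 2 10 popProg .skip)]

lemma eight_mul_le (k : ℕ) : 8 * (k + 1) ≤ 2 ^ (2 * k + 3) * (k + 1) := by
  refine Nat.mul_le_mul_right _ ?_
  calc 8 = 2 ^ 3 := by norm_num
    _ ≤ _ := Nat.pow_le_pow_right (by norm_num) (by omega)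

/-- As every vertex is entered once and left once, the number `2 * (n - #S) + l.length` of steps
still to come decreases. -/
lemma runs_stepProg {L n k : ℕ} {G : SimpleGraph (Fin n)} {S : Finset (Fin n)} {l : List (Fin n)}
    {s : State} (h : Represents G k S l s) (hlen : l.length < 2 * k + 2)
    (hL : n * n + 2 * n + 2 ^ (2 * k + 3) * (k + 1) < 2 ^ L) :
    Runs L stepProg s (184 * (4 ^ k * ((k + 1) * (n + 1)))) fun s' => s'.reg 11 = s.reg 11 ∧
      ∃ S' l', Represents G k S' l' s' ∧
        2 * (n - S'.card) + l'.length ≤ 2 * (n - S.card) + l.length - 1 := by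
  have h4 : 1 ≤ 4 ^ k := Nat.one_le_pow _ _ (by norm_num)
  have hpow : ∀ d ≤ 2 * k + 1, 4 * (2 ^ d * (k + 1)) ≤ 2 ^ (2 * k + 3) * (k + 1) := by
    intro d hd
    have := Nat.mul_le_mul_right (k + 1) (Nat.pow_le_pow_right (n := 2) (by norm_num) hd)
    calc _ ≤ 4 * (2 ^ (2 * k + 1) * (k + 1)) := by omega
      _ = _ := by ring
  have hcard : ∀ S : Finset (Fin n), S.card ≤ n := fun S => by simpa using S.card_le_univ
  have h8 := eight_mul_le k
  refine Runs.mono (Runs.cons (runs_findProg h (by omega)) fun s1 hs1 => Runs.cons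
    (Q := fun s' => s'.reg 11 = s.reg 11 ∧ ∃ S' l', Represents G k S' l' s' ∧
      2 * (n - S'.card) + l'.length ≤ 2 * (n - S.card) + l.length - 1)
    (T := 1 + (34 * k + 34 + 2 * 4 ^ k * (39 * k + 40)))
    (Runs.ifLt (fun hlt => ?_) fun hge => ?_) fun s2 hs2 => Runs.nil hs2) ?_ fun _ h => h
  · obtain ⟨hf, hm, h12⟩ := hs1
    have e0 : s1.reg 0 = n := by rw [hf 0 (by norm_num), h.registers.r0]
    have h1 := h.frame (hf.mono (by norm_num)) hm
    rcases h12 with ⟨h12, -⟩ | ⟨w, h12, h13, hw⟩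
    · omega
    refine (runs_pushProg h1 hw h12 h13 (by have := hpow l.length (by omega); omega)).mono ?_ ?_
    · have hp : 2 ^ l.length ≤ 2 * 4 ^ k := by
        calc 2 ^ l.length ≤ 2 ^ (2 * k + 1) := Nat.pow_le_pow_right (by norm_num) (by omega)
          _ = 2 * 4 ^ k := by rw [pow_succ, pow_mul]; norm_num [mul_comm]
      exact Nat.add_le_add (by omega) (Nat.mul_le_mul hp (by omega))
    · rintro s2 ⟨hf2, h11, hr⟩
      refine ⟨by rw [h11, hf 11 (by norm_num)], _, _, hr, ?_⟩
      have h2 := hcard (insert w S)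
      rw [Finset.card_insert_of_notMem hw.1] at h2 ⊢
      rw [List.length_cons]
      omega
  · obtain ⟨hf, hm, h12⟩ := hs1
    have e0 : s1.reg 0 = n := by rw [hf 0 (by norm_num), h.registers.r0]
    have e2 : s1.reg 2 = 0 := by rw [hf 2 (by norm_num), h.registers.r2]
    have e10 : s1.reg 10 = l.length := by rw [hf 10 (by norm_num), h.registers.r10]
    have h1 := h.frame (hf.mono (by norm_num)) hm
    have hnone : ∀ w, ¬ IsNext G S l w := by
      rcases h12 with ⟨-, h⟩ | ⟨w, h12, -, -⟩
      · exact h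
      · have := w.2
        omega
    refine Runs.mono (T := 1 + (33 * k + 33 + 2 * 4 ^ k * (39 * k + 40))) (Runs.ifLt
      (fun hpos => ?_) fun hz => ?_) (by omega) fun _ h => h
    · cases l with
      | nil => simp at e10; omega
      | cons v l =>
        rw [List.length_cons] at hlen
        refine (runs_popProg h1 ?_ (by have := hpow l.length (by omega); omega)).mono ?_ ?_
        · intro w hvw
          by_contra hw
          exact hnone w ⟨hw, by simpa using hvw⟩
        · have hp : 2 ^ l.length ≤ 4 ^ k := by
            calc 2 ^ l.length ≤ 2 ^ (2 * k) := Nat.pow_le_pow_right (by norm_num) (by omega)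
              _ = 4 ^ k := by rw [pow_mul]; norm_num
          refine Nat.add_le_add (by omega) ?_
          calc 2 ^ l.length * (k + 1) * 12 ≤ 4 ^ k * (k + 1) * 12 := by gcongr
            _ = 4 ^ k * (12 * k + 12) := by ring
            _ ≤ 2 * 4 ^ k * (39 * k + 40) := Nat.mul_le_mul (by omega) (by omega)
        · rintro s2 ⟨hf2, h11, hr⟩
          refine ⟨by rw [h11, hf 11 (by norm_num)], _, _, hr, ?_⟩
          rw [List.length_cons]
          omega
    · -- the search is complete
      have hl : l = [] := List.length_eq_zero_iff.1 (by omega)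
      subst hl
      have hS : S = Finset.univ := by
        ext w
        have := hnone w
        simpa [IsNext] using this
      refine (Runs.of_wp (p := .skip) (Q := fun s' => s' = s1) rfl).mono ?_ ?_
      · simp only [Prog.length]; omega
      · rintro _ rfl
        exact ⟨hf 11 (by norm_num), S, [], h1, by simp [hS]⟩
  · have h1 : 1 ≤ 4 ^ k * ((k + 1) * (n + 1)) := Nat.mul_pos h4 (by positivity)
    nlinarith [Nat.zero_le (4 ^ k * (k * n)), Nat.mul_le_mul_right n h4, Nat.mul_le_mul_right k h4]

/-! ### The algorithm -/

/-- Fill the registers, and store the table of the empty search path. -/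
def initProg : Prog :=
  block [block [.const 3 1, .add 4 1 3, .const 5 0], forLt 11 0 (block [.add 5 5 0]),
    block [.add 6 5 0, .add 7 6 0, .add 8 4 4, .add 9 0 0, .add 11 7 4, .store 11 3]]

lemma input_mem_of_le {n k a : ℕ} {G : SimpleGraph (Fin n)} (ha : n * n ≤ a) :
    (input G k).mem a = 0 := by
  refine if_neg ?_
  rintro ⟨u, v, -, rfl⟩
  exact (row_add_lt u v).not_ge ha

lemma adjAt_input {n k : ℕ} (G : SimpleGraph (Fin n)) : AdjAt G (input G k).mem := by
  classical
  intro u v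
  refine if_congr ⟨?_, fun h => ⟨u, v, h, rfl⟩⟩ rfl rfl
  rintro ⟨u', v', h, he⟩
  have hn : 0 < n := u.pos
  have hu : (u : ℕ) = u' := by
    have := congrArg (· / n) he
    simpa [mul_comm _ n, Nat.mul_add_div hn, Nat.div_eq_of_lt] using this
  rw [hu, Nat.add_left_cancel_iff] at he
  rwa [Fin.ext hu, Fin.ext he]

lemma runs_initProg {L n k : ℕ} (G : SimpleGraph (Fin n))
    (hL : n * n + 2 * n + 2 ^ (2 * k + 3) * (k + 1) < 2 ^ L) :
    Runs L initProg (input G k) (4 * n + 14) (Represents G k ∅ []) := by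
  have h0 : (input G k).reg 0 = n := rfl
  have h1 : (input G k).reg 1 = k := rfl
  have hother : ∀ i, i ≠ 0 → i ≠ 1 → (input G k).reg i = 0 := fun i h h' => by
    simp [input, h, h']
  have h8 := eight_mul_le k
  refine Runs.mono (Runs.cons (Q := fun s => s.mem = (input G k).mem ∧ s.reg 0 = n ∧ s.reg 1 = k ∧
      s.reg 2 = 0 ∧ s.reg 3 = 1 ∧ s.reg 4 = k + 1 ∧ s.reg 5 = 0 ∧ s.reg 10 = 0)
      (Runs.of_wp ?_) fun s1 hs1 =>
    Runs.cons (Runs.forLt (N := n) (T := 2) (fun m s => s.mem = (input G k).mem ∧ s.reg 0 = n ∧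
      s.reg 1 = k ∧ s.reg 2 = 0 ∧ s.reg 3 = 1 ∧ s.reg 4 = k + 1 ∧ s.reg 5 = m * n ∧ s.reg 10 = 0)
      ?_ ?_ ?_) fun s2 hs2 => Runs.cons (Runs.of_wp ?_) fun s3 hs3 => Runs.nil hs3) ?_ fun _ h => h
  · simp only [block, wp, State.setReg_reg, State.setReg_mem, ↓reduceIte, Nat.reduceEqDiff, h0, h1,
      hother 2 (by norm_num) (by norm_num), hother 10 (by norm_num) (by norm_num)]
    refine ⟨by omega, by omega, by omega, ?_⟩
    simp
  · intro m s _ h; exact h.2.1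
  · simpa using hs1
  · rintro m s hm hi ⟨hmem, e0, e1, e2, e3, e4, e5, e10⟩
    have := Nat.mul_le_mul_right n (Nat.succ_le_of_lt hm)
    rw [Nat.succ_mul] at this
    refine Runs.of_wp ?_
    simp only [block, wp, State.setReg_reg, State.setReg_mem, ↓reduceIte, Nat.reduceEqDiff, hi, e0,
      e1, e2, e3, e4, e5, e10, hmem]
    norm_num
    exact ⟨by omega, (Nat.succ_mul m n).symm⟩
  · obtain ⟨hmem, e0, e1, e2, e3, e4, e5, e10⟩ := hs2
    simp only [block, wp, State.setReg_reg, ↓reduceIte, Nat.reduceEqDiff, e0, e3, e4, e5]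
    refine ⟨by omega, by omega, by omega, by omega, by omega, ?_, .empty, ?_, ?_, trivial, ?_⟩
    · constructor <;> simp [e0, e1, e2, e3, e4, e5, e10] <;> omega
    · intro u v
      have := row_add_lt u v
      simp only [State.setReg_mem, State.setMem_mem, hmem]
      rw [if_neg (by omega), adjAt_input]
    · intro v
      have := v.2
      simp only [State.setReg_mem, State.setMem_mem, hmem]
      rw [if_neg (by omega), input_mem_of_le (by omega)]
      simp
    · intro χ hχ r hr b
      obtain rfl : χ = 0 := by simpa using hχ
      simp only [State.setReg_mem, State.setMem_mem, hmem, feasible_init, List.length_nil, pow_zero]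
      rw [input_mem_of_le (by omega)]
      split_ifs <;> omega
  · simp only [block, Prog.length]
    omega

/-- Output `1` if the search path has become long, and otherwise inspect the entry `k` of the only
row of the table of the empty search path. -/
def answerProg : Prog :=
  .ifLt 10 8 (block [.add 7 7 4, .add 7 7 1, .load 7 7, .ifLt 1 7 (.const 0 1) (.const 0 0)])
    (.const 0 1)

/-- A program that decides whether `k ≤ μ(G)`. -/
def loadColoringProg : Prog :=
  block [initProg, forLt 11 9 (.ifLt 10 8 stepProg .skip), answerProg]

lemma runs_loadColoringProg {L n k : ℕ} (G : SimpleGraph (Fin n))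
    (hL : n * n + 2 * n + 2 ^ (2 * k + 3) * (k + 1) < 2 ^ L) :
    Runs L loadColoringProg (input G k) (405 * (4 ^ k * ((k + 1) * (n + 1)) ^ 2)) fun s =>
      (k ≤ mu G → s.reg 0 = 1) ∧ (¬ k ≤ mu G → s.reg 0 = 0) := by
  have h4 : 1 ≤ 4 ^ k := Nat.one_le_pow _ _ (by norm_num)
  have h8 := eight_mul_le k
  refine Runs.mono (Runs.cons (runs_initProg G hL) fun s1 hs1 => Runs.cons
    (Runs.forLt (N := 2 * n) (T := 1 + 184 * (4 ^ k * ((k + 1) * (n + 1))))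
      (fun m s => ∃ S l, Represents G k S l s ∧
        (l.length < 2 * k + 2 → 2 * (n - S.card) + l.length ≤ 2 * n - m)) ?_ ?_ ?_)
    fun s2 hs2 => Runs.cons (Runs.of_wp ?_) fun s3 hs3 => Runs.nil hs3) ?_ fun _ h => h
  · rintro m s - ⟨S, l, h, -⟩
    exact h.registers.r9
  · exact ⟨∅, [], hs1.frame ((Frame.refl _ _).setReg (by norm_num)) rfl, by simp⟩
  · rintro m s hm hi ⟨S, l, h, hmeasure⟩
    refine Runs.ifLt (fun hlt => ?_) fun hge => ?_
    · rw [h.registers.r8, h.registers.r10] at hlt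
      refine (runs_stepProg h hlt hL).mono le_rfl ?_
      rintro s' ⟨h11, S', l', h', hle⟩
      have := hmeasure hlt
      exact ⟨by rw [h11, hi], h'.registers.r3, S', l',
        h'.frame ((Frame.refl _ _).setReg (by norm_num)) rfl, fun _ => by omega⟩
    · rw [h.registers.r8, h.registers.r10] at hge
      refine (Runs.of_wp (p := .skip) (Q := fun s' => s' = s) rfl).mono ?_ ?_
      · have : 1 ≤ 4 ^ k * ((k + 1) * (n + 1)) := Nat.mul_pos h4 (by positivity)
        simp only [Prog.length]
        omega
      · rintro _ rfl
        exact ⟨hi, h.registers.r3, S, l,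
          h.frame ((Frame.refl _ _).setReg (by norm_num)) rfl, fun h => absurd h hge⟩
  · obtain ⟨S, l, h, hmeasure⟩ := hs2
    obtain ⟨⟨r0, r1, r2, r3, r4, r5, r6, r7, r8, r9, r10⟩, hsearch, -, -, -, htable⟩ := h
    simp only [answerProg, block, wp, State.setReg_reg, State.setReg_mem, ↓reduceIte,
      Nat.reduceEqDiff, r1, r4, r7, r8, r10]
    refine ⟨fun hlt => ?_, fun hge => ?_⟩
    · have hm := hmeasure hlt
      obtain rfl : l = [] := List.length_eq_zero_iff.1 (by omega)
      have hcard : S.card = n := by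
        have : S.card ≤ n := by simpa using S.card_le_univ
        omega
      obtain rfl : S = Finset.univ := by
        rw [← Finset.card_eq_iff_eq_univ, hcard, Fintype.card_fin]
      have ht := htable 0 (by simp) k (by omega) k
      rw [feasible_final] at ht
      simp only [List.length_nil, pow_zero, one_mul, zero_mul, add_zero] at ht
      have h1L : 1 < 2 ^ L := by omega
      refine ⟨by omega, by omega, fun hk => ⟨h1L, ?_⟩, fun hk => ⟨by omega, ?_⟩⟩
      · simp [ht.1 hk]
      · have : ¬ k ≤ mu G := fun h => hk.not_gt (ht.2 h)
        simp [this]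
    · have := le_mu_of_path G hsearch.nodup hsearch.chain hge
      refine ⟨by omega, ?_⟩
      simp [this]
  · simp only [answerProg, block, Prog.length]
    generalize hX : (k + 1) * (n + 1) = X
    have hX1 : n + 1 ≤ X := hX ▸ Nat.le_mul_of_pos_left _ k.succ_pos
    have h5 : n + 1 ≤ 4 ^ k * X ^ 2 := by nlinarith
    have h6 : n * (4 ^ k * X) + 4 ^ k * X ≤ 4 ^ k * X ^ 2 := by
      calc n * (4 ^ k * X) + 4 ^ k * X = 4 ^ k * X * (n + 1) := by ring
        _ ≤ 4 ^ k * X * X := Nat.mul_le_mul_left _ hX1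
        _ = _ := by ring
    nlinarith

end LoadColoring

theorem theorem4p2 :
    ∃ (p : RAM.Prog) (C c : ℕ), ∀ (n : ℕ) (G : SimpleGraph (Fin n)) (k : ℕ),
      ∃ (t : ℕ) (s : RAM.State), RAM.Exec p (LoadColoring.input G k) t s ∧
        (k ≤ LoadColoring.mu G → s.reg 0 = 1) ∧
        (¬ k ≤ LoadColoring.mu G → s.reg 0 = 0) ∧
        t ≤ C * 4 ^ k * ((k + 1) * (n + 1)) ^ c := by
  refine ⟨LoadColoring.loadColoringProg, 3645, 3, fun n G k => ?_⟩
  -- all numbers that occur have at most `2 * n + 3 * k + 4` binary digits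
  have hn : n + 1 ≤ 2 ^ n := Nat.lt_two_pow_self
  have hk : k + 1 ≤ 2 ^ k := Nat.lt_two_pow_self
  have hL : n * n + 2 * n + 2 ^ (2 * k + 3) * (k + 1) < 2 ^ (2 * n + 3 * k + 4) := by
    have h1 : n * n + 2 * n < 2 ^ (2 * n + 3 * k + 3) := by
      calc n * n + 2 * n < (n + 1) * (n + 1) := by ring_nf; omega
        _ ≤ 2 ^ n * 2 ^ n := Nat.mul_le_mul hn hn
        _ = 2 ^ (n + n) := (pow_add 2 n n).symm
        _ ≤ _ := Nat.pow_le_pow_right (by norm_num) (by omega)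
    have h2 : 2 ^ (2 * k + 3) * (k + 1) ≤ 2 ^ (2 * n + 3 * k + 3) := by
      calc 2 ^ (2 * k + 3) * (k + 1) ≤ 2 ^ (2 * k + 3) * 2 ^ k := Nat.mul_le_mul_left _ hk
        _ = 2 ^ (2 * k + 3 + k) := (pow_add _ _ _).symm
        _ ≤ _ := Nat.pow_le_pow_right (by norm_num) (by omega)
    have h3 : 2 ^ (2 * n + 3 * k + 4) = 2 * 2 ^ (2 * n + 3 * k + 3) := by ring
    omega
  have hbdd : (LoadColoring.input G k).Bdd (2 * n + 3 * k + 4) := by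
    have h8 := LoadColoring.eight_mul_le k
    refine ⟨fun i => ?_, fun a => ?_⟩
    · simp only [LoadColoring.input]
      split_ifs <;> omega
    · simp only [LoadColoring.input]
      split_ifs <;> omega
  obtain ⟨t, s, hexec, ht, -, hyes, hno⟩ :=
    LoadColoring.runs_loadColoringProg G hL hbdd
  refine ⟨t, s, hexec, hyes, hno, ht.trans ?_⟩
  have hc : 2 * (2 * n + 3 * k + 4) + 1 ≤ 9 * ((k + 1) * (n + 1)) := by
    ring_nf
    nlinarith [Nat.zero_le (n * k)]
  calc _ ≤ 405 * (4 ^ k * ((k + 1) * (n + 1)) ^ 2) * (9 * ((k + 1) * (n + 1))) :=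
        Nat.mul_le_mul_left _ hc
    _ = _ := by ring
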